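/- **Theorem 12 (meta distribution of rate coverage).** Let $\lambda_{\rm r},\lambda_{\rm P},m,a,P_{\rm t},\sigma^2,B>0$ and $\alpha>1$. *Load.* Road-side units (RSUs) form a homogeneous Poisson point process (PPP) $\Phi$ on $\mathbb R$ of density $\lambda_{\rm r}$, and each vehicle is served by its nearest RSU. In non-platooned traffic (N-PTS) the vehicles form a PPP of density $\lambda=m\lambda_{\rm P}$ independent of $\Phi$. In platooned traffic (PTS) they form an independent Matérn cluster process: the parents form a PPP of density $\lambda_{\rm P}$, and each parent has Poisson($m$) many daughters, independently and uniformly placed at distance at most $a$ from it. Let $\mathrm p$ be the probability that the typical RSU (an RSU at the origin added to $\Phi$) has at least one vehicle in its Voronoi cell. Let $\widetilde S$ be the number of vehicles, other than a typical vehicle at the origin, in the tagged cell, i.e. the Voronoi cell of the RSU of $\Phi$ nearest to the origin. (Given a typical vehicle at the origin, the other vehicles are in N-PTS again the PPP; in PTS they are the Matérn process together with independent Poisson($m$) many points independently and uniformly placed at distance at most $a$ from a centre that is uniform on $[-a,a]$.) *Link.* Let $R$ be the distance from the origin to the nearest point of a PPP of density $\lambda_{\rm r}$ (serving RSU). The active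 RSUs are modelled as a PPP $\Phi_{\rm a}=\{\boldsymbol z_i\}$ of density $\mathrm p\lambda_{\rm r}$, and $H,H_1,H_2,\dots$ are i.i.d. unit-mean exponential fading gains. Put $$\mathrm{SINR}=\frac{HP_{\rm t}R^{-\alpha}}{I+\sigma^2},\qquad I=\sum_{i:\,|\boldsymbol z_i|>R}H_iP_{\rm t}|\boldsymbol z_i|^{-\alpha},\qquad \mathcal R_{\rm c}=\frac{B}{\widetilde S+1}\log_2(1+\mathrm{SINR}),$$ where the serving process, $\Phi_{\rm a}$, the fading of the serving link, the fading of the interfering links, and the load $\widetilde S$ are taken to be mutually independent. Let $\mathcal G$ be the information on the locations of the serving process and of $\Phi_{\rm a}$, and define $$\mathrm P_{\rm c}(\theta)=\mathbb P[\mathrm{SINR}>\theta\mid\mathcal G],\qquad \mathrm R_{\rm c}(\tau)=\mathbb P[\mathcal R_{\rm c}>\tau\mid\mathcal G,\widetilde S],$$ $$\overline F_{\mathrm P_{\rm c}(\theta)}(x)=\mathbb P[\mathrm P_{\rm c}(\theta)>x],\qquad \overline F_{\mathrm R_{\rm c}(\tau)}(x)=\mathbb P[\mathrm R_{\rm c}(\tau)>x].$$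 Then, both in PTS and in N-PTS, for every $\tau>0$ and every real $x$, with $\gamma(y)=2^y-1$, $$\overline F_{\mathrm R_{\rm c}(\tau)}(x)=\sum_{k=0}^\infty\mathbb P[\widetilde S=k]\;\overline F_{\mathrm P_{\rm c}(\gamma(\tau(k+1)/B))}(x).$$ Here, for every $x>0$ and every $\theta=\gamma(\tau(k+1)/B)$, $k\ge 0$, the coverage meta distribution is given by the improper integral (limit of $\int_0^T$ as $T\to\infty$) $$\overline F_{\mathrm P_{\rm c}(\theta)}(x)=\frac12-\frac1\pi\int_0^\infty\frac1t\int_0^\infty f_{\rm r}(t,r)\,\sin\big(f_{\rm i}(t,r)+\Theta(t,r)\big)\,2\lambda_{\rm r}e^{-2\lambda_{\rm r}r}\,dr\,dt,$$ where, with $\eta=1+1/\alpha$, $$f_{\rm r}(t,r)=\exp\Big(-\frac{2\mathrm p\lambda_{\rm r}r}{\alpha}\int_0^1\big(1-\cos(t\ln(1+\theta y))\big)y^{-\eta}\,dy\Big),$$ $$f_{\rm i}(t,r)=\frac{2\mathrm p\lambda_{\rm r}r}{\alpha}\int_0^1\sin(t\ln(1+\theta y))\,y^{-\eta}\,dy,\qquad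 \Theta(t,r)=\frac{t\theta r^\alpha\sigma^2}{P_{\rm t}}+t\ln x.$$ -/

import Mathlib

open MeasureTheory ProbabilityTheory Filter Topology

noncomputable section

/-! Random point processes on the line -/

/-- The number (with multiplicity) of points of the sequence `z` that lie in `A`. -/
def pointCount {Ω : Type*} (z : ℕ → Ω → ℝ) (ω : Ω) (A : Set ℝ) : ℕ∞ :=
  {i : ℕ | z i ω ∈ A}.encard

/-- The random points `z 0, z 1, …` form a homogeneous Poisson point process on `ℝ` of density
`lam`: the counts in sets of finite length are Poisson distributed with mean `lam * length`, and
the counts in disjoint sets are independent. -/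
structure IsPoissonProcess {Ω : Type*} [MeasurableSpace Ω] (μ : Measure Ω)
    (z : ℕ → Ω → ℝ) (lam : ℝ) : Prop where
  measurable : ∀ i, Measurable (z i)
  hasLaw_count : ∀ A : Set ℝ, MeasurableSet A → volume A ≠ ⊤ →
    HasLaw (fun ω => pointCount z ω A)
      ((poissonMeasure (lam * volume.real A).toNNReal).map (fun n : ℕ => (n : ℕ∞))) μ
  indep_count : ∀ (n : ℕ) (A : Fin n → Set ℝ), (∀ j, MeasurableSet (A j)) →
    (∀ j, volume (A j) ≠ ⊤) → Pairwise (fun i j => Disjoint (A i) (A j)) →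
    iIndepFun (fun j ω => pointCount z ω (A j)) μ

/-- The sigma-algebra generated by a random element. -/
abbrev sigmaOf {Ω β : Type*} [MeasurableSpace β] (f : Ω → β) : MeasurableSpace Ω :=
  MeasurableSpace.comap f inferInstance

/-! Parameters -/

/-- The parameters of the highway model. -/
structure HighwayParams where
  /-- density of road-side units -/
  lamR : ℝ
  /-- density of platoons (parent points) -/
  lamP : ℝ
  /-- mean number of vehicles of a platoon -/
  m : ℝ
  /-- radius of a platoon -/
  a : ℝ
  /-- path-loss exponent -/
  α : ℝ
  /-- transmit power -/
  Pt : ℝ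
  /-- noise power (the variance `σ²`) -/
  noise : ℝ
  /-- bandwidth -/
  B : ℝ
  lamR_pos : 0 < lamR
  lamP_pos : 0 < lamP
  m_pos : 0 < m
  a_pos : 0 < a
  one_lt_α : 1 < α
  Pt_pos : 0 < Pt
  noise_pos : 0 < noise
  B_pos : 0 < B

/-- The two traffic scenarios: platooned traffic and non-platooned traffic. -/
inductive Scenario
  | platooned
  | nonPlatooned

/-! The load of a road-side unit -/

/-- The random ingredients of the traffic network. Platoons are indexed by `Option ℕ`: the platoon
`none` is the one of the typical vehicle, the platoons `some i` are all the other ones. -/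
structure Traffic (Ω : Type*) where
  /-- locations of the road-side units -/
  rsu : ℕ → Ω → ℝ
  /-- locations of the vehicles in non-platooned traffic -/
  vehicle : ℕ → Ω → ℝ
  /-- centre of a platoon -/
  center : Option ℕ → Ω → ℝ
  /-- number of vehicles of a platoon (for `none`: without the typical vehicle) -/
  size : Option ℕ → Ω → ℕ
  /-- position of the vehicles of a platoon relative to its centre; the `j`-th one is present if
  `j` is less than the size -/
  offset : Option ℕ × ℕ → Ω → ℝ

namespace Traffic

variable {Ω : Type*}

/-- The laws of the ingredients. Road-side units form a Poisson process, vehicles in non-platooned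
traffic form a Poisson process of density `m * lamP`, platoons form a Matérn cluster process with
parent density `lamP`, Poisson(`m`) many daughters per parent, placed uniformly at distance at most
`a` of the parent. The typical vehicle is at the origin, so that the centre of its platoon is
uniform in `[-a, a]`. -/
structure IsModel [MeasurableSpace Ω] (N : Traffic Ω) (μ : Measure Ω) (c : HighwayParams) :
    Prop where
  rsu_poisson : IsPoissonProcess μ N.rsu c.lamR
  vehicle_poisson : IsPoissonProcess μ N.vehicle (c.m * c.lamP)
  parent_poisson : IsPoissonProcess μ (fun i => N.center (some i)) c.lamP
  measurable_center_none : Measurable (N.center none)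
  center_none_law : HasLaw (N.center none) (volume[|Set.Icc (-c.a) c.a]) μ
  measurable_size : ∀ i, Measurable (N.size i)
  size_law : ∀ i, HasLaw (N.size i) (poissonMeasure c.m.toNNReal) μ
  size_indep : iIndepFun N.size μ
  measurable_offset : ∀ q, Measurable (N.offset q)
  offset_law : ∀ q, HasLaw (N.offset q) (volume[|Set.Icc (-c.a) c.a]) μ
  offset_indep : iIndepFun N.offset μ
  /-- the different kinds of ingredients are independent -/
  indep : iIndep ![sigmaOf (fun ω i => N.rsu i ω), sigmaOf (fun ω i => N.vehicle i ω),
    sigmaOf (fun ω (i : ℕ) => N.center (some i) ω), sigmaOf (N.center none),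
    sigmaOf (fun ω i => N.size i ω), sigmaOf (fun ω q => N.offset q ω)] μ

/-- The Voronoi cell of the typical road-side unit, which is located at the origin. -/
def typicalCell (N : Traffic Ω) (ω : Ω) : Set ℝ :=
  {y | ∀ j, |y| ≤ |y - N.rsu j ω|}

/-- The Voronoi cell of the tagged road-side unit, that is, of the one nearest to the typical
vehicle at the origin. -/
def taggedCell (N : Traffic Ω) (ω : Ω) : Set ℝ :=
  {y | ∃ i, (∀ j, |N.rsu i ω| ≤ |N.rsu j ω|) ∧ ∀ j, |y - N.rsu i ω| ≤ |y - N.rsu j ω|}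

/-- The number of vehicles of the Matérn cluster process in `A`. -/
def clusterCount (N : Traffic Ω) (ω : Ω) (A : Set ℝ) : ℕ∞ :=
  {q : ℕ × ℕ | q.2 < N.size (some q.1) ω ∧
    N.center (some q.1) ω + N.offset (some q.1, q.2) ω ∈ A}.encard

/-- The number of vehicles in `A` that belong to the platoon of the typical vehicle, apart from the
typical vehicle. -/
def ownPlatoonCount (N : Traffic Ω) (ω : Ω) (A : Set ℝ) : ℕ∞ :=
  {j : ℕ | j < N.size none ω ∧ N.center none ω + N.offset (none, j) ω ∈ A}.encard

/-- The load on the typical road-side unit. -/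
def typicalLoad (N : Traffic Ω) : Scenario → Ω → ℕ∞
  | .platooned, ω => N.clusterCount ω (N.typicalCell ω)
  | .nonPlatooned, ω => pointCount N.vehicle ω (N.typicalCell ω)

/-- The load on the tagged road-side unit, not counting the typical vehicle. -/
def taggedLoad (N : Traffic Ω) : Scenario → Ω → ℕ∞
  | .platooned, ω => N.clusterCount ω (N.taggedCell ω) + N.ownPlatoonCount ω (N.taggedCell ω)
  | .nonPlatooned, ω => pointCount N.vehicle ω (N.taggedCell ω)

/-- The probability that the typical road-side unit serves at least one vehicle. -/
def activeProb [MeasurableSpace Ω] (N : Traffic Ω) (μ : Measure Ω) (s : Scenario) : ℝ :=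
  μ.real {ω | N.typicalLoad s ω ≠ 0}

end Traffic

/-! The link of the typical vehicle -/

/-- The random ingredients of the downlink of the typical vehicle at the origin. -/
structure Link (Ω : Type*) where
  /-- locations of the road-side units, the nearest of which is serving -/
  rsu : ℕ → Ω → ℝ
  /-- locations of the active road-side units -/
  active : ℕ → Ω → ℝ
  /-- fading gain of the serving link -/
  gain : Ω → ℝ
  /-- fading gains of the interfering links -/
  gains : ℕ → Ω → ℝ
  /-- load on the tagged road-side unit, not counting the typical vehicle -/
  load : Ω → ℕ

namespace Link

variable {Ω : Type*}

/-- The laws of the ingredients: the road-side units form a Poisson process, the active ones are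
modelled as a Poisson process whose density is thinned by the active probability, all links have
Rayleigh fading, and the load has the law of the load on the tagged road-side unit. Road-side
units, active interferers, fading and load are modelled as independent. -/
structure IsModel [MeasurableSpace Ω] (L : Link Ω) (μ : Measure Ω) (c : HighwayParams)
    {Ω' : Type*} [MeasurableSpace Ω'] (N : Traffic Ω') (ν : Measure Ω') (s : Scenario) :
    Prop where
  rsu_poisson : IsPoissonProcess μ L.rsu c.lamR
  active_poisson : IsPoissonProcess μ L.active (N.activeProb ν s * c.lamR)
  measurable_gain : Measurable L.gain
  gain_law : HasLaw L.gain (expMeasure 1) μ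
  measurable_gains : ∀ i, Measurable (L.gains i)
  gains_law : ∀ i, HasLaw (L.gains i) (expMeasure 1) μ
  gains_indep : iIndepFun L.gains μ
  measurable_load : Measurable L.load
  load_law : IdentDistrib (fun ω => (L.load ω : ℕ∞)) (N.taggedLoad s) μ ν
  indep : iIndep ![sigmaOf (fun ω i => L.rsu i ω), sigmaOf (fun ω i => L.active i ω),
    sigmaOf L.gain, sigmaOf (fun ω i => L.gains i ω), sigmaOf L.load] μ

/-- The distance from the typical vehicle to its serving (nearest) road-side unit. -/
def servingDist (L : Link Ω) (ω : Ω) : ℝ := ⨅ i, |L.rsu i ω|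

open Classical in
/-- The interference from the active road-side units farther away than the serving one. -/
def interference (L : Link Ω) (c : HighwayParams) (ω : Ω) : ℝ :=
  ∑' i, if L.servingDist ω < |L.active i ω| then
    L.gains i ω * c.Pt * |L.active i ω| ^ (-c.α) else 0

/-- The signal-to-interference-plus-noise ratio of the typical vehicle. -/
def sinr (L : Link Ω) (c : HighwayParams) (ω : Ω) : ℝ :=
  L.gain ω * c.Pt * L.servingDist ω ^ (-c.α) / (L.interference c ω + c.noise)

/-- The rate of the typical vehicle. -/
def rate (L : Link Ω) (c : HighwayParams) (ω : Ω) : ℝ :=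
  c.B / (L.load ω + 1) * Real.logb 2 (1 + L.sinr c ω)

/-- The information on the locations of the serving and of the active road-side units. -/
abbrev geometry (L : Link Ω) : MeasurableSpace Ω :=
  sigmaOf (fun ω i => L.rsu i ω) ⊔ sigmaOf (fun ω i => L.active i ω)

variable [MeasurableSpace Ω]

/-- The coverage probability for a given realisation of the network. -/
def condCoverage (L : Link Ω) (μ : Measure Ω) (c : HighwayParams) (θ : ℝ) : Ω → ℝ :=
  μ⟦{ω | θ < L.sinr c ω}|L.geometry⟧

/-- The meta distribution of the coverage probability. -/
def coverageMeta (L : Link Ω) (μ : Measure Ω) (c : HighwayParams) (θ x : ℝ) : ℝ :=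
  μ.real {ω | x < L.condCoverage μ c θ ω}

/-- The rate coverage for a given realisation of the network and of the load. -/
def condRateCoverage (L : Link Ω) (μ : Measure Ω) (c : HighwayParams) (τ : ℝ) : Ω → ℝ :=
  μ⟦{ω | τ < L.rate c ω}|L.geometry ⊔ sigmaOf L.load⟧

/-- The meta distribution of the rate coverage. -/
def rateMeta (L : Link Ω) (μ : Measure Ω) (c : HighwayParams) (τ x : ℝ) : ℝ :=
  μ.real {ω | x < L.condRateCoverage μ c τ ω}

end Link

/-! The explicit expression for the meta distribution of the coverage probability -/

/-- The SINR threshold that corresponds to the spectral efficiency `x`. -/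
def sinrThreshold (x : ℝ) : ℝ := 2 ^ x - 1

/-- The modulus factor, at active probability `p`, threshold `θ`, serving distance `r`. -/
def metaModulus (c : HighwayParams) (p θ t r : ℝ) : ℝ :=
  Real.exp (-(2 * p * c.lamR * r / c.α) *
    ∫ y in (0 : ℝ)..1, (1 - Real.cos (t * Real.log (1 + θ * y))) * y ^ (-(1 + 1 / c.α)))

/-- The phase caused by the interference. -/
def metaPhase (c : HighwayParams) (p θ t r : ℝ) : ℝ :=
  (2 * p * c.lamR * r / c.α) *
    ∫ y in (0 : ℝ)..1, Real.sin (t * Real.log (1 + θ * y)) * y ^ (-(1 + 1 / c.α))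

/-- The phase caused by the noise and by the reliability level `x`. -/
def metaShift (c : HighwayParams) (θ x t r : ℝ) : ℝ :=
  t * θ * r ^ c.α / (c.Pt / c.noise) + t * Real.log x

/-- The inversion integral for the meta distribution of the coverage probability, truncated at
`T`. -/
def coverageMetaTrunc (c : HighwayParams) (p θ x T : ℝ) : ℝ :=
  1 / 2 - 1 / Real.pi * ∫ t in (0 : ℝ)..T,
    (∫ r in Set.Ioi (0 : ℝ), metaModulus c p θ t r *
      Real.sin (metaPhase c p θ t r + metaShift c θ x t r) *
        (2 * c.lamR * Real.exp (-2 * c.lamR * r))) / t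

end

noncomputable section

/-! ### The Dirichlet integral and the Gil-Pelaez inversion formula -/

/-! Fix the locations. With serving distance `r`, the event `θ < SINR` says that the serving gain
exceeds a threshold determined by the noise and the interfering gains. That gain is exponential, and
so are the interfering ones, so averaging over the fading turns the conditional coverage into `exp
(-E)`. Here `E` is the noise term `θ r^α σ² / Pt` plus the sum of `log (1 + w i)` over the active
units, where `w i = θ (r / |z i|)^α` beyond distance `r` and `0` otherwise
(`Link.IsModel.condCoverage_ae_eq`).

The rate exceeds `τ` exactly when the SINR exceeds a threshold that depends on the load alone.
Conditional rate coverage is therefore `exp (-E)` at that random threshold. Since load and locations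
are independent, splitting over the values of the load gives the series
(`Link.IsModel.hasSum_rateMeta`). The traffic scenario enters only through the number `p` and the
law of the load, so one argument serves both scenarios.

For `x > 0`, the coverage meta distribution is the probability that `Y = E + log x` is negative.
Gil-Pelaez inversion (`tendsto_gilPelaez`) writes it as `1/2` minus an improper integral of `E[sin
(t Y)] / (π t)`, provided that `Y` is integrable and has no atom at `0`. Integrability follows from
Campbell's formula and `α > 1`. There is no atom because, for fixed interferers, `E` increases
strictly in `r` as long as the set of points within distance `r` does not change; only countably
many such sets occur, and `r` has a density.

The expected sine is computed for fixed `r` from the characteristic functional of a Poisson process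
(`IsPoissonProcess.integral_cexp_tsum`) and the substitution `|v| = r y^(-1/α)`. It is then
integrated against the exponential law of the serving distance, which comes from the void
probabilities. -/

lemma integral_exp_neg_mul_Ioi {t : ℝ} (ht : 0 < t) :
    ∫ s in Set.Ioi (0 : ℝ), Real.exp (-(t * s)) = 1 / t := by
  have := integral_exp_mul_Ioi (neg_lt_zero.mpr ht) 0
  simpa [neg_mul, neg_div_neg_eq] using this

lemma integrableOn_exp_neg_mul_Ioi {t : ℝ} (ht : 0 < t) :
    IntegrableOn (fun s => Real.exp (-(t * s))) (Set.Ioi 0) := by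
  simpa [neg_mul] using integrableOn_exp_mul_Ioi (neg_lt_zero.mpr ht) 0

lemma integral_sin_mul_exp_neg (s T : ℝ) :
    ∫ t in (0 : ℝ)..T, Real.sin t * Real.exp (-(t * s)) =
      (1 + s ^ 2)⁻¹ - Real.exp (-(T * s)) * ((Real.cos T + s * Real.sin T) / (1 + s ^ 2)) := by
  have h : ∀ t ∈ Set.uIcc 0 T, HasDerivAt
      (fun t => -(Real.exp (-(t * s)) * ((Real.cos t + s * Real.sin t) / (1 + s ^ 2))))
      (Real.sin t * Real.exp (-(t * s))) t := by
    intro t _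
    have h1 : HasDerivAt (fun t : ℝ => Real.exp (-(t * s))) (Real.exp (-(t * s)) * (-(1 * s))) t :=
      (((hasDerivAt_id t).mul_const s).neg).exp
    have h2 : HasDerivAt (fun t : ℝ => (Real.cos t + s * Real.sin t) / (1 + s ^ 2))
        ((-Real.sin t + s * Real.cos t) / (1 + s ^ 2)) t :=
      ((Real.hasDerivAt_cos t).add ((Real.hasDerivAt_sin t).const_mul s)).div_const _
    convert! (h1.mul h2).neg using 1
    have : (1 + s ^ 2) ≠ 0 := by positivity
    field_simp
    ring
  rw [intervalIntegral.integral_eq_sub_of_hasDerivAt h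
    ((by fun_prop : Continuous fun t => Real.sin t * Real.exp (-(t * s))).intervalIntegrable _ _)]
  simp
  ring

lemma norm_exp_neg_mul_div_le {s : ℝ} (hs : 0 < s) (T : ℝ) :
    ‖Real.exp (-(T * s)) * ((Real.cos T + s * Real.sin T) / (1 + s ^ 2))‖ ≤
      Real.exp (-(T * s)) * 2 := by
  rw [norm_mul, Real.norm_eq_abs, Real.abs_exp, Real.norm_eq_abs, abs_div,
    abs_of_pos (by positivity : 0 < 1 + s ^ 2)]
  refine mul_le_mul_of_nonneg_left ?_ (Real.exp_pos _).le
  rw [div_le_iff₀ (by positivity)]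
  calc |Real.cos T + s * Real.sin T| ≤ |Real.cos T| + |s * Real.sin T| := abs_add_le _ _
    _ ≤ 1 + s * 1 := by
      rw [abs_mul, abs_of_pos hs]
      gcongr
      · exact Real.abs_cos_le_one T
      · exact Real.abs_sin_le_one T
    -- The constant `2` makes the bound uniform in `s`, so that integrating over `s` leaves an error
    -- of `2 / T`.
    _ ≤ 2 * (1 + s ^ 2) := by nlinarith [sq_nonneg (s - 1)]

/-- Write `1 / t` as the integral of `exp (-(t s))` over `s > 0` and exchange the integrals. The
inner integral over `t` is elementary, and its part independent of `T` integrates to `π / 2`. -/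
lemma integral_sinc_eq {T : ℝ} (hT : 0 < T) :
    ∫ t in (0 : ℝ)..T, Real.sinc t = Real.pi / 2 -
      ∫ s in Set.Ioi (0 : ℝ),
        Real.exp (-(T * s)) * ((Real.cos T + s * Real.sin T) / (1 + s ^ 2)) := by
  have hmeas : Measurable (Function.uncurry fun t s : ℝ => Real.sin t * Real.exp (-(t * s))) := by
    unfold Function.uncurry
    fun_prop
  have hint : Integrable (Function.uncurry fun t s : ℝ => Real.sin t * Real.exp (-(t * s)))
      ((volume.restrict (Set.uIoc 0 T)).prod (volume.restrict (Set.Ioi 0))) := by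
    rw [integrable_prod_iff hmeas.aestronglyMeasurable]
    rw [Set.uIoc_of_le hT.le]
    constructor
    · refine (ae_restrict_iff' measurableSet_Ioc).mpr (ae_of_all _ fun t ht => ?_)
      exact (integrableOn_exp_neg_mul_Ioi ht.1).const_mul (Real.sin t)
    · have : Set.EqOn (fun t => ∫ s in Set.Ioi (0 : ℝ),
          ‖Function.uncurry (fun t s : ℝ => Real.sin t * Real.exp (-(t * s))) (t, s)‖)
          (fun t => |Real.sinc t|) (Set.Ioc 0 T) := by
        intro t ht
        simp only [Function.uncurry, norm_mul, Real.norm_eq_abs, Real.abs_exp]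
        rw [integral_const_mul, integral_exp_neg_mul_Ioi ht.1, Real.sinc_of_ne_zero ht.1.ne',
          abs_div, abs_of_pos ht.1]
        ring
      change IntegrableOn _ _ _
      rw [integrableOn_congr_fun this measurableSet_Ioc]
      exact (Real.continuous_sinc.abs.integrableOn_Icc).mono_set Set.Ioc_subset_Icc_self
  have h1 : ∫ t in (0 : ℝ)..T, Real.sinc t =
      ∫ t in (0 : ℝ)..T, ∫ s in Set.Ioi (0 : ℝ), Real.sin t * Real.exp (-(t * s)) := by
    rw [intervalIntegral.integral_of_le hT.le, intervalIntegral.integral_of_le hT.le]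
    refine setIntegral_congr_fun measurableSet_Ioc fun t ht => ?_
    rw [integral_const_mul, integral_exp_neg_mul_Ioi ht.1, Real.sinc_of_ne_zero ht.1.ne']
    ring
  rw [h1, intervalIntegral_integral_swap hint]
  simp_rw [integral_sin_mul_exp_neg]
  have hR : IntegrableOn (fun s => Real.exp (-(T * s)) *
      ((Real.cos T + s * Real.sin T) / (1 + s ^ 2))) (Set.Ioi 0) := by
    refine ((integrableOn_exp_neg_mul_Ioi hT).mul_const 2).mono'
      (Measurable.aestronglyMeasurable (by fun_prop)) ?_
    exact (ae_restrict_iff' measurableSet_Ioi).mpr (ae_of_all _ fun s hs =>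
      norm_exp_neg_mul_div_le hs T)
  rw [integral_sub (integrable_inv_one_add_sq.integrableOn) hR, integral_Ioi_inv_one_add_sq]
  simp

lemma abs_integral_sinc_sub_le {T : ℝ} (hT : 0 < T) :
    |(∫ t in (0 : ℝ)..T, Real.sinc t) - Real.pi / 2| ≤ 2 / T := by
  rw [integral_sinc_eq hT, sub_sub_cancel_left, abs_neg]
  have h2 : ∫ s in Set.Ioi (0 : ℝ), Real.exp (-(T * s)) * 2 = 2 / T := by
    rw [integral_mul_const, integral_exp_neg_mul_Ioi hT]
    ring
  rw [← h2, ← Real.norm_eq_abs]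
  refine norm_integral_le_of_norm_le ((integrableOn_exp_neg_mul_Ioi hT).mul_const 2) ?_
  exact (ae_restrict_iff' measurableSet_Ioi).mpr (ae_of_all _ fun s hs =>
    norm_exp_neg_mul_div_le hs T)

/-- The Dirichlet integral. -/
lemma tendsto_integral_sinc :
    Tendsto (fun T : ℝ => ∫ t in (0 : ℝ)..T, Real.sinc t) atTop (𝓝 (Real.pi / 2)) := by
  rw [tendsto_iff_norm_sub_tendsto_zero]
  refine squeeze_zero' (Eventually.of_forall fun _ => norm_nonneg _) ?_
    (tendsto_const_nhds.div_atTop tendsto_id : Tendsto (fun T : ℝ => 2 / T) atTop (𝓝 0))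
  filter_upwards [eventually_gt_atTop 0] with T hT using abs_integral_sinc_sub_le hT

lemma abs_integral_sinc_le_of_nonneg {T : ℝ} (hT : 0 ≤ T) :
    |∫ t in (0 : ℝ)..T, Real.sinc t| ≤ Real.pi / 2 + 2 := by
  have hpi := Real.pi_pos
  rcases le_total T 1 with h | h
  · have := intervalIntegral.norm_integral_le_of_norm_le_const (a := 0) (b := T) (C := 1)
      (f := Real.sinc) fun t _ => Real.abs_sinc_le_one t
    rw [Real.norm_eq_abs, sub_zero, abs_of_nonneg hT] at this
    linarith
  · have h1 := abs_integral_sinc_sub_le (zero_lt_one.trans_le h)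
    have h2 : 2 / T ≤ 2 := div_le_self zero_le_two h
    have h3 := abs_sub_abs_le_abs_sub (∫ t in (0 : ℝ)..T, Real.sinc t) (Real.pi / 2)
    rw [abs_of_pos (by positivity : 0 < Real.pi / 2)] at h3
    linarith

lemma integral_sin_mul_div (y T : ℝ) :
    ∫ t in (0 : ℝ)..T, Real.sin (t * y) / t = ∫ t in (0 : ℝ)..(T * y), Real.sinc t := by
  rcases eq_or_ne y 0 with rfl | hy
  · simp
  · have h := intervalIntegral.integral_comp_mul_right (a := 0) (b := T) Real.sinc hy
    rw [zero_mul, smul_eq_mul] at h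
    have h2 : ∫ t in (0 : ℝ)..(T * y), Real.sinc t = y * ∫ t in (0 : ℝ)..T, Real.sinc (t * y) := by
      rw [h]
      field_simp
    rw [h2, ← intervalIntegral.integral_const_mul]
    refine intervalIntegral.integral_congr_ae ?_
    have : ∀ᵐ t : ℝ, t ≠ 0 := by simp [ae_iff]
    filter_upwards [this] with t ht _
    rw [Real.sinc_of_ne_zero (mul_ne_zero ht hy)]
    field_simp

lemma integral_sinc_neg (T : ℝ) :
    ∫ t in (0 : ℝ)..(-T), Real.sinc t = -∫ t in (0 : ℝ)..T, Real.sinc t := by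
  have := intervalIntegral.integral_comp_neg (a := 0) (b := T) Real.sinc
  simp only [Real.sinc_neg, neg_zero] at this
  rw [this, intervalIntegral.integral_symm]

/-- A bound uniform in `T`, which serves as the dominating constant when the inversion integral
passes to the limit. -/
lemma abs_integral_sinc_le (T : ℝ) :
    |∫ t in (0 : ℝ)..T, Real.sinc t| ≤ Real.pi / 2 + 2 := by
  rcases le_total 0 T with h | h
  · exact abs_integral_sinc_le_of_nonneg h
  · rw [← neg_neg T, integral_sinc_neg, abs_neg]
    exact abs_integral_sinc_le_of_nonneg (neg_nonneg.mpr h)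

lemma tendsto_integral_sin_mul_div (y : ℝ) :
    Tendsto (fun T : ℝ => ∫ t in (0 : ℝ)..T, Real.sin (t * y) / t) atTop
      (𝓝 (Real.pi / 2 * SignType.sign y)) := by
  simp_rw [integral_sin_mul_div]
  rcases lt_trichotomy y 0 with h | rfl | h
  · have : (fun T : ℝ => ∫ t in (0 : ℝ)..(T * y), Real.sinc t) =
        fun T : ℝ => -∫ t in (0 : ℝ)..(T * -y), Real.sinc t := by
      ext T
      rw [← integral_sinc_neg]
      simp
    rw [this, sign_neg h]
    simpa using (tendsto_integral_sinc.comp (tendsto_id.atTop_mul_const (neg_pos.mpr h))).neg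
  · simp
  · rw [sign_pos h]
    simpa [Function.comp_def] using tendsto_integral_sinc.comp (tendsto_id.atTop_mul_const h)

/-- The Gil-Pelaez inversion formula for the probability of a negative value. -/
theorem tendsto_gilPelaez {Ω : Type*} [MeasurableSpace Ω] {μ : Measure Ω} [IsProbabilityMeasure μ]
    {Y : Ω → ℝ} (hY : Measurable Y) (hint : Integrable Y μ) (h0 : μ {ω | Y ω = 0} = 0) :
    Tendsto (fun T : ℝ => 1 / 2 - 1 / Real.pi *
        ∫ t in (0 : ℝ)..T, (∫ ω, Real.sin (t * Y ω) ∂μ) / t) atTop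
      (𝓝 (μ.real {ω | Y ω < 0})) := by
  have hswap : ∀ T : ℝ, ∫ t in (0 : ℝ)..T, (∫ ω, Real.sin (t * Y ω) ∂μ) / t =
      ∫ ω, (∫ t in (0 : ℝ)..T, Real.sin (t * Y ω) / t) ∂μ := by
    intro T
    simp_rw [← integral_div]
    -- Fubini applies because `|sin (t Y) / t| ≤ |Y|`, which is integrable over a bounded range of
    -- `t`; this is where integrability of `Y` enters. At `t = 0` the quotient is `0` by convention.
    refine intervalIntegral_integral_swap ?_
    have hm : Measurable (Function.uncurry fun (t : ℝ) ω => Real.sin (t * Y ω) / t) := by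
      unfold Function.uncurry
      fun_prop
    refine Integrable.mono' (g := fun p : ℝ × Ω => |Y p.2|) ?_ hm.aestronglyMeasurable ?_
    · have : IsFiniteMeasure (volume.restrict (Set.uIoc 0 T)) := by
        unfold Set.uIoc
        infer_instance
      exact hint.abs.comp_snd _
    · refine ae_of_all _ fun p => ?_
      simp only [Function.uncurry, Real.norm_eq_abs, abs_div]
      refine div_le_of_le_mul₀ (abs_nonneg _) (abs_nonneg _) ?_
      rw [← abs_mul, mul_comm (Y p.2)]
      exact Real.abs_sin_le_abs
  have hlim : Tendsto (fun T : ℝ => ∫ ω, (∫ t in (0 : ℝ)..T, Real.sin (t * Y ω) / t) ∂μ) atTop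
      (𝓝 (∫ ω, Real.pi / 2 * (SignType.sign (Y ω) : ℝ) ∂μ)) := by
    refine tendsto_integral_filter_of_dominated_convergence (fun _ => Real.pi / 2 + 2) ?_ ?_
      (integrable_const _) (ae_of_all _ fun ω => tendsto_integral_sin_mul_div _)
    · refine Eventually.of_forall fun T => ?_
      simp_rw [integral_sin_mul_div]
      have hc : Continuous fun x : ℝ => ∫ t in (0 : ℝ)..x, Real.sinc t :=
        intervalIntegral.continuous_primitive
          (fun a b => Real.continuous_sinc.intervalIntegrable a b) 0
      exact (hc.measurable.comp (hY.const_mul T)).aestronglyMeasurable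
    · refine Eventually.of_forall fun T => ae_of_all _ fun ω => ?_
      rw [integral_sin_mul_div, Real.norm_eq_abs]
      exact abs_integral_sinc_le _
  have hneg : MeasurableSet {ω | Y ω < 0} := measurableSet_lt hY measurable_const
  have hval : ∫ ω, Real.pi / 2 * (SignType.sign (Y ω) : ℝ) ∂μ =
      Real.pi / 2 * (1 - 2 * μ.real {ω | Y ω < 0}) := by
    rw [integral_const_mul]
    congr 1
    -- This identity fails only where `Y = 0`, a null set by `h0`.
    have : (fun ω => (SignType.sign (Y ω) : ℝ)) =ᵐ[μ]
        fun ω => 1 - 2 * {ω | Y ω < 0}.indicator (fun _ => (1 : ℝ)) ω := by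
      have h0' : ∀ᵐ ω ∂μ, Y ω ≠ 0 := by simpa [ae_iff] using h0
      filter_upwards [h0'] with ω hω
      rcases lt_or_gt_of_ne hω with h | h
      · simp [sign_neg h, h]
        norm_num
      · simp [sign_pos h, not_lt.mpr h.le]
    rw [integral_congr_ae this, integral_sub (integrable_const _)
      (((integrable_const _).indicator hneg).const_mul _), integral_const_mul,
      integral_indicator_const _ hneg]
    simp
  simp_rw [hswap]
  have := (hlim.const_mul (1 / Real.pi)).const_sub (1 / 2)
  rw [hval] at this
  convert this using 2
  have := Real.pi_ne_zero
  field_simp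
  ring

/-! ### Poisson processes: Campbell's formula and the characteristic functional -/

lemma lintegral_natCast_poissonMeasure (r : NNReal) :
    ∫⁻ n, (n : ENNReal) ∂(poissonMeasure r) = r := by
  have hterm : ∀ n : ℕ, ENNReal.ofReal (Real.exp (-r) * r ^ (n + 1) / (n + 1).factorial) *
      ((n + 1 : ℕ) : ENNReal) = r * ENNReal.ofReal (Real.exp (-r) * r ^ n / n.factorial) := by
    intro n
    rw [← ENNReal.ofReal_natCast (n + 1), ← ENNReal.ofReal_mul (by positivity),
      ← ENNReal.ofReal_coe_nnreal, ← ENNReal.ofReal_mul (by positivity)]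
    congr 1
    rw [Nat.factorial_succ]
    push_cast
    field_simp
    ring
  have hone : ∑' n : ℕ, ENNReal.ofReal (Real.exp (-r) * r ^ n / n.factorial) = 1 := by
    rw [← ENNReal.ofReal_tsum_of_nonneg (fun n => by positivity)
      (hasSum_one_poissonMeasure r).summable, (hasSum_one_poissonMeasure r).tsum_eq,
      ENNReal.ofReal_one]
  rw [poissonMeasure, lintegral_sum_measure]
  simp only [lintegral_smul_measure, lintegral_dirac, smul_eq_mul]
  rw [tsum_eq_zero_add' ENNReal.summable]
  simp_rw [hterm]
  rw [ENNReal.tsum_mul_left, hone]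
  simp

lemma tsum_indicator_eq_encard {ι : Type*} (s : Set ι) :
    ∑' i, s.indicator (fun _ => (1 : ENNReal)) i = (s.encard : ENNReal) := by
  rw [← ENNReal.tsum_set_one, tsum_subtype s (fun _ => (1 : ENNReal))]

/-- A constant summed over a finite set of indices. -/
lemma hasSum_indicator_encard_toNat {ι : Type*} {s : Set ι} (hs : s.encard ≠ ⊤) (c : ℝ) :
    HasSum (s.indicator fun _ => c) (c * s.encard.toNat) := by
  have hf : s.Finite := Set.encard_ne_top_iff.mp hs
  have h : HasSum (s.indicator fun _ => c) (∑ i ∈ hf.toFinset, s.indicator (fun _ => c) i) :=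
    hasSum_sum_of_ne_finset_zero fun i hi => by
      simpa using fun h => absurd h (by simpa using hi)
  convert h using 1
  rw [Finset.sum_congr rfl fun i hi => Set.indicator_of_mem (by simpa using hi) _]
  rw [Finset.sum_const, nsmul_eq_mul, mul_comm, hf.encard_eq_coe_toFinset_card]
  rfl

namespace IsPoissonProcess

variable {Ω : Type*} [MeasurableSpace Ω] {μ : Measure Ω} {z : ℕ → Ω → ℝ} {lam : ℝ}

lemma lintegral_pointCount (h : IsPoissonProcess μ z lam) (hlam : 0 ≤ lam) {A : Set ℝ}
    (hA : MeasurableSet A) (hA' : volume A ≠ ⊤) :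
    ∫⁻ ω, (pointCount z ω A : ENNReal) ∂μ = ENNReal.ofReal lam * volume A := by
  have h1 := (h.hasLaw_count A hA hA').lintegral_comp (f := fun n : ℕ∞ => (n : ENNReal))
    (Measurable.of_discrete).aemeasurable
  rw [h1, lintegral_map .of_discrete .of_discrete]
  simp only [ENat.toENNReal_coe]
  rw [lintegral_natCast_poissonMeasure]
  change ENNReal.ofReal _ = _
  rw [ENNReal.ofReal_mul hlam, ofReal_measureReal hA']

lemma ae_pointCount_ne_top (h : IsPoissonProcess μ z lam) {A : Set ℝ}
    (hA : MeasurableSet A) (hA' : volume A ≠ ⊤) : ∀ᵐ ω ∂μ, pointCount z ω A ≠ ⊤ := by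
  have h1 := (h.hasLaw_count A hA hA').measure_eq (p := fun n => n = ⊤) .of_discrete
  rw [Measure.map_apply .of_discrete .of_discrete] at h1
  have h2 : (fun n : ℕ => (n : ℕ∞)) ⁻¹' {n | n = ⊤} = ∅ := by
    ext n
    simp
  rw [h2, measure_empty] at h1
  simpa [ae_iff] using h1

/-- The intensity measure of the process. Summing the indicators of `z i ∈ A` gives the mean count
of `A`, which is known on sets of finite length. -/
lemma sum_map_eq (h : IsPoissonProcess μ z lam) (hlam : 0 ≤ lam) :
    Measure.sum (fun i => μ.map (z i)) = ENNReal.ofReal lam • (volume : Measure ℝ) := by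
  have hfin : ∀ A : Set ℝ, MeasurableSet A → volume A ≠ ⊤ →
      Measure.sum (fun i => μ.map (z i)) A = ENNReal.ofReal lam * volume A := by
    intro A hA hA'
    rw [← h.lintegral_pointCount hlam hA hA', Measure.sum_apply _ hA]
    simp_rw [pointCount, ← tsum_indicator_eq_encard]
    have : ∀ i, (fun ω => {i | z i ω ∈ A}.indicator (fun _ => (1 : ENNReal)) i) =
        (z i ⁻¹' A).indicator fun _ => 1 := by
      intro i
      rfl
    rw [lintegral_tsum fun i => ?_]
    · refine tsum_congr fun i => ?_
      rw [this, lintegral_indicator_const (h.measurable i hA), one_mul,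
        Measure.map_apply (h.measurable i) hA]
    · rw [this]
      exact (measurable_const.indicator (h.measurable i hA)).aemeasurable
  -- Mean counts are prescribed only for finite length, so the measures are compared on each set of
  -- an exhausting sequence.
  rw [Measure.ext_iff_of_iUnion_eq_univ (iUnion_spanningSets (volume : Measure ℝ))]
  intro i
  ext A hA
  rw [Measure.restrict_apply hA, Measure.restrict_apply hA, hfin _
    (hA.inter (measurableSet_spanningSets _ _))
    (measure_ne_top_of_subset Set.inter_subset_right (measure_spanningSets_lt_top _ _).ne)]
  simp

/-- Campbell's formula. -/
lemma lintegral_tsum_comp (h : IsPoissonProcess μ z lam) (hlam : 0 ≤ lam) {f : ℝ → ENNReal}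
    (hf : Measurable f) :
    ∫⁻ ω, ∑' i, f (z i ω) ∂μ = ENNReal.ofReal lam * ∫⁻ v, f v := by
  rw [lintegral_tsum (f := fun i ω => f (z i ω))
    fun i => (hf.comp (h.measurable i)).aemeasurable]
  calc ∑' i, ∫⁻ ω, f (z i ω) ∂μ = ∑' i, ∫⁻ v, f v ∂(μ.map (z i)) := by
        simp_rw [lintegral_map hf (h.measurable _)]
    _ = _ := by
      rw [← lintegral_sum_measure, h.sum_map_eq hlam, lintegral_smul_measure, smul_eq_mul]

lemma ae_summable_norm (h : IsPoissonProcess μ z lam) (hlam : 0 ≤ lam) {f : ℝ → ℝ}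
    (hf : Measurable f) (hint : Integrable f) : ∀ᵐ ω ∂μ, Summable fun i => ‖f (z i ω)‖ := by
  have h1 := h.lintegral_tsum_comp hlam hf.enorm
  have h2 : ∫⁻ ω, ∑' i, ‖f (z i ω)‖ₑ ∂μ ≠ ⊤ := by
    rw [h1]
    exact ENNReal.mul_ne_top ENNReal.ofReal_ne_top hint.2.ne
  have h3 : Measurable fun ω => ∑' i, ‖f (z i ω)‖ₑ :=
    Measurable.tsum fun i => (hf.comp (h.measurable i)).enorm
  filter_upwards [ae_lt_top h3 h2] with ω hω
  have := ENNReal.summable_toReal hω.ne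
  simpa using this

lemma lintegral_enorm_tsum_le (h : IsPoissonProcess μ z lam) (hlam : 0 ≤ lam) {f : ℝ → ℝ}
    (hf : Measurable f) :
    ∫⁻ ω, ‖∑' i, f (z i ω)‖ₑ ∂μ ≤ ENNReal.ofReal lam * ∫⁻ v, ‖f v‖ₑ := by
  rw [← h.lintegral_tsum_comp hlam hf.enorm]
  exact lintegral_mono fun ω => enorm_tsum_le_tsum_enorm

lemma measurable_tsum_comp (h : IsPoissonProcess μ z lam) {f : ℝ → ℝ} (hf : Measurable f) :
    Measurable fun ω => ∑' i, f (z i ω) :=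
  Measurable.tsum fun i => hf.comp (h.measurable i)

lemma integral_cexp_pointCount (h : IsPoissonProcess μ z lam) (hlam : 0 ≤ lam) {A : Set ℝ}
    (hA : MeasurableSet A) (hA' : volume A ≠ ⊤) (c : ℝ) :
    ∫ ω, Complex.exp (Complex.I * (c * (pointCount z ω A).toNat : ℝ)) ∂μ =
      Complex.exp (lam * volume.real A * (Complex.exp (Complex.I * c) - 1)) := by
  have h1 := (h.hasLaw_count A hA hA').integral_comp
    (f := fun n : ℕ∞ => Complex.exp (Complex.I * (c * n.toNat : ℝ)))
    (Measurable.of_discrete).aestronglyMeasurable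
  simp only [Function.comp_def] at h1
  rw [h1, integral_map .of_discrete (Measurable.of_discrete).aestronglyMeasurable]
  have h2 := charFun_map_cast_poissonMeasure (lam * volume.real A).toNNReal c
  rw [charFun_apply, integral_map .of_discrete (by fun_prop)] at h2
  have h3 : (((lam * volume.real A).toNNReal : ℝ) : ℂ) = lam * volume.real A := by
    rw [Real.coe_toNNReal _ (by positivity)]
    push_cast
    ring
  rw [← h3]
  convert h2 using 1
  · refine integral_congr_ae (ae_of_all _ fun n => ?_)
    simp
    ring_nf
  · simp [mul_comm]

end IsPoissonProcess

lemma norm_cexp_I_sub_cexp_I_le (x y : ℝ) :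
    ‖Complex.exp (Complex.I * x) - Complex.exp (Complex.I * y)‖ ≤ |x - y| := by
  have : Complex.exp (Complex.I * x) - Complex.exp (Complex.I * y) =
      Complex.exp (Complex.I * y) * (Complex.exp (Complex.I * (x - y : ℝ)) - 1) := by
    rw [mul_sub, ← Complex.exp_add]
    push_cast
    ring_nf
  rw [this, norm_mul, Complex.norm_exp_I_mul_ofReal, one_mul]
  exact Real.norm_exp_I_mul_ofReal_sub_one_le

lemma norm_one_sub_cexp_I_le (x : ℝ) : ‖1 - Complex.exp (Complex.I * x)‖ ≤ |x| := by
  rw [norm_sub_rev]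
  exact Real.norm_exp_I_mul_ofReal_sub_one_le

lemma integrable_one_sub_cexp_I {f : ℝ → ℝ} (hf : Measurable f) (hint : Integrable f) :
    Integrable fun v => 1 - Complex.exp (Complex.I * f v) := by
  refine hint.mono (Measurable.aestronglyMeasurable (by fun_prop)) (ae_of_all _ fun v => ?_)
  exact norm_one_sub_cexp_I_le _

namespace IsPoissonProcess

variable {Ω : Type*} [MeasurableSpace Ω] {μ : Measure Ω} {z : ℕ → Ω → ℝ} {lam : ℝ}

/-- The sum over the points is a linear combination of the counts in the level sets of `f`. These
counts are independent Poisson variables, so the expectation factors into Poisson characteristic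
functions. -/
lemma integral_cexp_tsum_simpleFunc (h : IsPoissonProcess μ z lam) (hlam : 0 ≤ lam)
    (f : SimpleFunc ℝ ℝ) (hint : Integrable f) :
    ∫ ω, Complex.exp (Complex.I * (∑' i, f (z i ω) : ℝ)) ∂μ =
      Complex.exp (-(lam * ∫ v, (1 - Complex.exp (Complex.I * f v)))) := by
  classical
  -- The value `0` contributes nothing, and its level set has infinite length; all other level sets
  -- have finite length.
  set F : Finset ℝ := f.range.erase 0
  have hm : ∀ c : ℝ, MeasurableSet (f ⁻¹' {c}) := fun c => f.measurableSet_preimage _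
  have hfin : ∀ c ∈ F, volume (f ⁻¹' {c}) ≠ ⊤ := fun c hc =>
    (SimpleFunc.measure_preimage_lt_top_of_integrable f hint (Finset.ne_of_mem_erase hc)).ne
  have hsumf : ∀ v, f v = ∑ c ∈ F, (f ⁻¹' {c}).indicator (fun _ => c) v := by
    intro v
    by_cases hv : f v = 0
    · rw [hv]
      refine (Finset.sum_eq_zero fun c hc => ?_).symm
      have : c ≠ 0 := Finset.ne_of_mem_erase hc
      simp [Set.indicator, hv, this.symm]
    · rw [Finset.sum_eq_single_of_mem (f v)
        (Finset.mem_erase.mpr ⟨hv, SimpleFunc.mem_range_self f v⟩)]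
      · simp
      · intro c _ hc
        simp [Set.indicator, hc.symm]
  let e := F.equivFin.symm
  let A : Fin F.card → Set ℝ := fun j => f ⁻¹' {(e j : ℝ)}
  have hA : ∀ j, MeasurableSet (A j) := fun j => hm _
  have hA' : ∀ j, volume (A j) ≠ ⊤ := fun j => hfin _ (e j).2
  have hdisj : Pairwise fun i j => Disjoint (A i) (A j) := by
    intro i j hij
    refine Disjoint.preimage _ ?_
    rw [Set.disjoint_singleton]
    exact fun heq => hij (e.injective (Subtype.ext heq))
  have hcount : ∀ᵐ ω ∂μ, ∑' i, f (z i ω) =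
      ∑ j, (e j : ℝ) * (pointCount z ω (A j)).toNat := by
    filter_upwards [ae_all_iff.mpr fun j => h.ae_pointCount_ne_top (hA j) (hA' j)] with ω hω
    have h1 : ∀ j, HasSum (fun i => (A j).indicator (fun _ => (e j : ℝ)) (z i ω))
        ((e j : ℝ) * (pointCount z ω (A j)).toNat) := by
      intro j
      exact hasSum_indicator_encard_toNat (hω j) (e j : ℝ)
    have h2 := hasSum_sum fun j (_ : j ∈ Finset.univ) => h1 j
    rw [← h2.tsum_eq]
    refine tsum_congr fun i => ?_
    rw [hsumf (z i ω), ← Finset.sum_coe_sort F]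
    exact (Equiv.sum_comp e fun c : F => (f ⁻¹' {(c : ℝ)}).indicator (fun _ => (c : ℝ)) _).symm
  calc ∫ ω, Complex.exp (Complex.I * (∑' i, f (z i ω) : ℝ)) ∂μ
      = ∫ ω, ∏ j, Complex.exp (Complex.I *
          ((e j : ℝ) * (pointCount z ω (A j)).toNat : ℝ)) ∂μ := by
        refine integral_congr_ae ?_
        filter_upwards [hcount] with ω hω
        rw [hω, ← Complex.exp_sum, ← Finset.mul_sum]
        push_cast
        rfl
    _ = ∏ j, ∫ ω, Complex.exp (Complex.I *
          ((e j : ℝ) * (pointCount z ω (A j)).toNat : ℝ)) ∂μ := by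
        refine iIndepFun.integral_fun_prod_comp (X := fun j ω => pointCount z ω (A j))
          (f := fun j n => Complex.exp (Complex.I * ((e j : ℝ) * n.toNat : ℝ)))
          (h.indep_count _ A hA hA' hdisj) (fun j => ?_) fun j => ?_
        · exact (h.hasLaw_count _ (hA j) (hA' j)).aemeasurable
        · exact (Measurable.of_discrete).aestronglyMeasurable
    _ = ∏ j, Complex.exp (lam * volume.real (A j) *
          (Complex.exp (Complex.I * (e j : ℝ)) - 1)) := by
        simp_rw [h.integral_cexp_pointCount hlam (hA _) (hA' _)]
    _ = Complex.exp (-(lam * ∑ j, volume.real (A j) *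
          (1 - Complex.exp (Complex.I * (e j : ℝ))))) := by
        rw [← Complex.exp_sum, Finset.mul_sum, ← Finset.sum_neg_distrib]
        congr 1
        refine Finset.sum_congr rfl fun j _ => ?_
        ring
    _ = _ := by
        congr 3
        have h3 : ∀ v, 1 - Complex.exp (Complex.I * f v) = ∑ c ∈ F,
            (f ⁻¹' {c}).indicator (fun _ => 1 - Complex.exp (Complex.I * c)) v := by
          intro v
          by_cases hv : f v = 0
          · rw [hv]
            refine Eq.trans (by simp) (Finset.sum_eq_zero fun c hc => ?_).symm
            have : c ≠ 0 := Finset.ne_of_mem_erase hc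
            simp [Set.indicator, hv, this.symm]
          · rw [Finset.sum_eq_single_of_mem (f v)
              (Finset.mem_erase.mpr ⟨hv, SimpleFunc.mem_range_self f v⟩)]
            · simp
            · intro c _ hc
              simp [Set.indicator, hc.symm]
        simp_rw [h3]
        rw [integral_finsetSum _ fun c hc =>
          (integrable_indicator_iff (hm c)).mpr (integrableOn_const (hfin c hc))]
        simp_rw [integral_indicator_const _ (hm _)]
        rw [← Finset.sum_coe_sort F, ← Equiv.sum_comp e]
        simp [A]

/-- The characteristic functional of a Poisson process. -/
theorem integral_cexp_tsum (h : IsPoissonProcess μ z lam) (hlam : 0 ≤ lam) [IsProbabilityMeasure μ]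
    {f : ℝ → ℝ} (hf : Measurable f) (hint : Integrable f) :
    ∫ ω, Complex.exp (Complex.I * (∑' i, f (z i ω) : ℝ)) ∂μ =
      Complex.exp (-(lam * ∫ v, (1 - Complex.exp (Complex.I * f v)))) := by
  -- Both sides are continuous in `f` for the `L¹` norm, because `x ↦ exp (i x)` is 1-Lipschitz. On
  -- the left, Campbell's formula bounds the mean change of the sum by `lam` times the `L¹`
  -- distance.
  let g : ℕ → SimpleFunc ℝ ℝ := fun n =>
    SimpleFunc.approxOn f hf (Set.range f ∪ {0}) 0 (by simp) n
  have hg : ∀ n, Integrable (g n) := fun n => SimpleFunc.integrable_approxOn_range hf hint n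
  have hlim : Tendsto (fun n => ∫⁻ v, ‖g n v - f v‖ₑ) atTop (𝓝 0) :=
    SimpleFunc.tendsto_approxOn_range_L1_enorm hf hint
  have hL : Tendsto (fun n => ∫ ω, Complex.exp (Complex.I * (∑' i, g n (z i ω) : ℝ)) ∂μ) atTop
      (𝓝 (∫ ω, Complex.exp (Complex.I * (∑' i, f (z i ω) : ℝ)) ∂μ)) := by
    have hI : ∀ u : ℝ → ℝ, Measurable u →
        Integrable (fun ω => Complex.exp (Complex.I * (∑' i, u (z i ω) : ℝ))) μ := by
      intro u hu
      refine (integrable_const (1 : ℝ)).mono' ?_ (ae_of_all _ fun ω => ?_)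
      · have := h.measurable_tsum_comp hu
        exact Measurable.aestronglyMeasurable (by fun_prop)
      · rw [Complex.norm_exp_I_mul_ofReal]
    refine tendsto_integral_of_L1 _ (hI f hf).aestronglyMeasurable
      (Eventually.of_forall fun n => hI _ (g n).measurable) ?_
    have hub : Tendsto (fun n => ENNReal.ofReal lam * ∫⁻ v, ‖g n v - f v‖ₑ) atTop (𝓝 0) := by
      simpa using ENNReal.Tendsto.const_mul hlim (Or.inr ENNReal.ofReal_ne_top)
    refine tendsto_of_tendsto_of_tendsto_of_le_of_le tendsto_const_nhds hub (fun _ => zero_le)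
      fun n => ?_
    refine le_trans ?_ (h.lintegral_enorm_tsum_le hlam ((g n).measurable.sub hf))
    refine lintegral_mono_ae ?_
    filter_upwards [h.ae_summable_norm hlam hf hint,
      h.ae_summable_norm hlam (g n).measurable (hg n)] with ω h1 h2
    rw [(h2.of_norm).tsum_sub h1.of_norm]
    rw [enorm_le_iff_norm_le]
    exact norm_cexp_I_sub_cexp_I_le _ _
  have hR : Tendsto (fun n => ∫ v, (1 - Complex.exp (Complex.I * g n v))) atTop
      (𝓝 (∫ v, (1 - Complex.exp (Complex.I * f v)))) := by
    refine tendsto_integral_of_L1 _ (integrable_one_sub_cexp_I hf hint).aestronglyMeasurable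
      (Eventually.of_forall fun n => integrable_one_sub_cexp_I (g n).measurable (hg n)) ?_
    refine tendsto_of_tendsto_of_tendsto_of_le_of_le tendsto_const_nhds hlim (fun _ => zero_le)
      fun n => lintegral_mono fun v => ?_
    rw [enorm_le_iff_norm_le, sub_sub_sub_cancel_left, norm_sub_rev]
    exact norm_cexp_I_sub_cexp_I_le _ _
  refine tendsto_nhds_unique hL ?_
  simp_rw [fun n => h.integral_cexp_tsum_simpleFunc hlam (g n) (hg n)]
  exact (Complex.continuous_exp.tendsto _).comp ((hR.const_mul _).neg)

end IsPoissonProcess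

/-! ### Exponential random variables -/

lemma expMeasure_eq_withDensity (r : ℝ) :
    expMeasure r = (volume.restrict (Set.Ioi 0)).withDensity
      fun x => ENNReal.ofReal (r * Real.exp (-(r * x))) := by
  rw [← withDensity_indicator measurableSet_Ioi, expMeasure, gammaMeasure]
  refine withDensity_congr_ae ?_
  have : ∀ᵐ t : ℝ, t ≠ 0 := by simp [ae_iff]
  filter_upwards [this] with x hx
  rcases lt_or_gt_of_ne hx with h | h
  · rw [gammaPDF_of_neg h, Set.indicator_of_notMem (by simpa using h.le)]
  · rw [gammaPDF_of_nonneg h.le, Set.indicator_of_mem (by simpa using h)]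
    simp

lemma integral_expMeasure {r : ℝ} (hr : 0 < r) (f : ℝ → ℝ) :
    ∫ x, f x ∂(expMeasure r) = ∫ x in Set.Ioi (0 : ℝ), f x * (r * Real.exp (-(r * x))) := by
  rw [expMeasure_eq_withDensity, integral_withDensity_eq_integral_toReal_smul (by fun_prop)
    (ae_of_all _ fun _ => ENNReal.ofReal_lt_top)]
  refine integral_congr_ae (ae_of_all _ fun x => ?_)
  simp only [smul_eq_mul]
  rw [ENNReal.toReal_ofReal (by positivity), mul_comm]

lemma integrable_expMeasure_iff {r : ℝ} (hr : 0 < r) {f : ℝ → ℝ} :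
    Integrable f (expMeasure r) ↔
      IntegrableOn (fun x => f x * (r * Real.exp (-(r * x)))) (Set.Ioi 0) := by
  rw [expMeasure_eq_withDensity, integrable_withDensity_iff (by fun_prop)
    (ae_of_all _ fun _ => ENNReal.ofReal_lt_top)]
  refine integrable_congr (ae_of_all _ fun x => ?_)
  simp only
  rw [ENNReal.toReal_ofReal (by positivity)]

lemma expMeasure_absolutelyContinuous (r : ℝ) : expMeasure r ≪ volume := by
  rw [expMeasure_eq_withDensity]
  exact (withDensity_absolutelyContinuous _ _).trans Measure.absolutelyContinuous_restrict

lemma ae_pos_expMeasure (r : ℝ) : ∀ᵐ x ∂(expMeasure r), 0 < x := by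
  rw [expMeasure_eq_withDensity]
  exact (withDensity_absolutelyContinuous _ _).ae_le (ae_restrict_mem measurableSet_Ioi)

lemma expMeasure_Ioi {r : ℝ} (hr : 0 < r) {x : ℝ} (hx : 0 ≤ x) :
    expMeasure r (Set.Ioi x) = ENNReal.ofReal (Real.exp (-(r * x))) := by
  have := isProbabilityMeasure_expMeasure hr
  have h := cdf_expMeasure_eq hr x
  rw [cdf_eq_real, if_pos hx] at h
  rw [← Set.compl_Iic, ← ofReal_measureReal, probReal_compl_eq_one_sub measurableSet_Iic, h]
  simp

lemma expMeasure_Ici {r : ℝ} (hr : 0 < r) {x : ℝ} (hx : 0 ≤ x) :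
    expMeasure r (Set.Ici x) = ENNReal.ofReal (Real.exp (-(r * x))) := by
  rw [← expMeasure_Ioi hr hx]
  refine measure_congr ?_
  exact (expMeasure_absolutelyContinuous r).ae_le Ioi_ae_eq_Ici.symm

/-- Needed because the coverage exponent grows like the power `α` of the serving distance. The power
is absorbed by half of the exponential decay. -/
lemma integrable_one_add_rpow_expMeasure {r : ℝ} (hr : 0 < r) (β : ℝ) :
    Integrable (fun x => (1 + |x|) ^ β) (expMeasure r) := by
  rw [integrable_expMeasure_iff hr]
  have hcont : ContinuousOn (fun x : ℝ => (1 + |x|) ^ β * (r * Real.exp (-(r * x))))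
      (Set.Ici 0) := by
    refine ContinuousOn.mul (ContinuousOn.rpow_const (by fun_prop) fun x _ => Or.inl ?_)
      (by fun_prop)
    positivity
  refine integrable_of_isBigO_exp_neg (b := r / 2) (by positivity) hcont ?_
  have h1 : (fun x : ℝ => (1 + |x|) ^ β) =O[atTop] fun x => Real.exp (r / 2 * x) := by
    have h2 := isLittleO_rpow_exp_pos_mul_atTop β (b := r / 2) (by positivity)
    have h3 : Tendsto (fun x : ℝ => 1 + x) atTop atTop := tendsto_atTop_add_const_left _ _ tendsto_id
    have h4 := (h2.comp_tendsto h3).isBigO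
    have h5 : ((fun x => Real.exp (r / 2 * x)) ∘ fun x : ℝ => 1 + x) =
        fun x => Real.exp (r / 2) * Real.exp (r / 2 * x) := by
      ext x
      rw [Function.comp_apply, ← Real.exp_add]
      ring_nf
    rw [h5] at h4
    have h6 := h4.trans (Asymptotics.isBigO_const_mul_self _ _ _)
    refine h6.congr' ?_ EventuallyEq.rfl
    filter_upwards [eventually_ge_atTop 0] with x hx
    simp [abs_of_nonneg hx]
  have h7 := h1.mul (Asymptotics.isBigO_refl (fun x : ℝ => r * Real.exp (-(r * x))) atTop)
  refine h7.trans ?_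
  have h8 : (fun x : ℝ => Real.exp (r / 2 * x) * (r * Real.exp (-(r * x)))) =
      fun x => r * Real.exp (-(r / 2) * x) := by
    ext x
    rw [mul_left_comm, ← Real.exp_add]
    ring_nf
  rw [h8]
  exact Asymptotics.isBigO_const_mul_self _ _ _

lemma integrable_id_expMeasure {r : ℝ} (hr : 0 < r) : Integrable (fun x => x) (expMeasure r) := by
  refine (integrable_one_add_rpow_expMeasure hr 1).mono' (by fun_prop) (ae_of_all _ fun x => ?_)
  rw [Real.rpow_one, Real.norm_eq_abs]
  linarith

/-- The value `1 / (1 + s)` is kept as `exp (-log (1 + s))` so that products over interferers become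
sums of logarithms. -/
lemma integral_exp_neg_mul_expMeasure {s : ℝ} (hs : 0 ≤ s) :
    ∫ x, Real.exp (-(s * x)) ∂(expMeasure 1) = Real.exp (-Real.log (1 + s)) := by
  rw [integral_expMeasure one_pos]
  have : ∀ x : ℝ, Real.exp (-(s * x)) * (1 * Real.exp (-(1 * x))) = Real.exp (-((1 + s) * x)) := by
    intro x
    rw [one_mul, ← Real.exp_add]
    ring_nf
  simp_rw [this]
  rw [integral_exp_neg_mul_Ioi (by positivity), Real.exp_neg, Real.exp_log (by positivity),
    one_div]

section Fading

variable {Ω : Type*} [MeasurableSpace Ω] {μ : Measure Ω}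

/-- The probability that an independent exponential variable exceeds a nonnegative threshold. -/
lemma measureReal_lt_exponential [IsProbabilityMeasure μ] {V H : Ω → ℝ} (hV : Measurable V)
    (hH : Measurable H) (hlaw : HasLaw H (expMeasure 1) μ) (hind : IndepFun V H μ)
    (hV0 : ∀ᵐ ω ∂μ, 0 ≤ V ω) :
    μ.real {ω | V ω < H ω} = ∫ ω, Real.exp (-V ω) ∂μ := by
  have := isProbabilityMeasure_expMeasure one_pos
  have hprod := (indepFun_iff_map_prod_eq_prod_map_map hV.aemeasurable hH.aemeasurable).mp hind
  rw [hlaw.map_eq] at hprod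
  have hS : MeasurableSet {p : ℝ × ℝ | p.1 < p.2} := measurableSet_lt measurable_fst measurable_snd
  have h1 : μ {ω | V ω < H ω} = ∫⁻ ω, ENNReal.ofReal (Real.exp (-V ω)) ∂μ := by
    calc μ {ω | V ω < H ω} = μ.map (fun ω => (V ω, H ω)) {p : ℝ × ℝ | p.1 < p.2} := by
          rw [Measure.map_apply (hV.prodMk hH) hS]
          rfl
      _ = ∫⁻ v, expMeasure 1 (Set.Ioi v) ∂(μ.map V) := by
          rw [hprod, Measure.prod_apply hS]
          rfl
      _ = ∫⁻ ω, expMeasure 1 (Set.Ioi (V ω)) ∂μ := by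
          exact lintegral_map (f := fun v => expMeasure 1 (Set.Ioi v))
            (measurable_measure_prodMk_left hS) hV
      _ = _ := by
          refine lintegral_congr_ae ?_
          filter_upwards [hV0] with ω hω
          rw [expMeasure_Ioi one_pos hω, one_mul]
  rw [measureReal_def, h1, integral_eq_lintegral_of_nonneg_ae
    (ae_of_all _ fun ω => (Real.exp_pos _).le) (Measurable.aestronglyMeasurable (by fun_prop))]

variable {g : ℕ → Ω → ℝ}

lemma ae_nonneg_of_exponential {H : Ω → ℝ} (hlaw : HasLaw H (expMeasure 1) μ) :
    ∀ᵐ ω ∂μ, 0 ≤ H ω := by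
  have h := ae_pos_expMeasure 1
  rw [← hlaw.map_eq] at h
  filter_upwards [ae_of_ae_map hlaw.aemeasurable h] with ω hω using hω.le

/-- The expected sum is finite. Without summability, `tsum` would take its default value `0` and say
nothing about the partial sums. -/
lemma ae_summable_mul_exponential (hm : ∀ i, Measurable (g i))
    (hlaw : ∀ i, HasLaw (g i) (expMeasure 1) μ) {s : ℕ → ℝ} (hs0 : ∀ i, 0 ≤ s i)
    (hs : Summable s) : ∀ᵐ ω ∂μ, Summable fun i => s i * g i ω := by
  have h1 : ∫⁻ ω, ∑' i, ‖s i * g i ω‖ₑ ∂μ ≠ ⊤ := by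
    rw [lintegral_tsum fun i => ((hm i).const_mul (s i)).enorm.aemeasurable]
    have : ∀ i, ∫⁻ ω, ‖s i * g i ω‖ₑ ∂μ =
        ENNReal.ofReal (s i) * ∫⁻ x, ‖x‖ₑ ∂(expMeasure 1) := by
      intro i
      simp_rw [enorm_mul]
      rw [lintegral_const_mul _ (hm i).enorm, Real.enorm_of_nonneg (hs0 i),
        (hlaw i).lintegral_comp (f := fun x => ‖x‖ₑ) (by fun_prop)]
    simp_rw [this]
    rw [ENNReal.tsum_mul_right, ← ENNReal.ofReal_tsum_of_nonneg hs0 hs]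
    exact ENNReal.mul_ne_top ENNReal.ofReal_ne_top (integrable_id_expMeasure one_pos).2.ne
  have h2 : Measurable fun ω => ∑' i, ‖s i * g i ω‖ₑ :=
    Measurable.tsum fun i => ((hm i).const_mul (s i)).enorm
  filter_upwards [ae_lt_top h2 h1] with ω hω
  have := ENNReal.summable_toReal hω.ne
  simp only [toReal_enorm] at this
  exact this.of_norm

/-- The Laplace transform of a weighted sum of independent exponential variables. -/
lemma integral_exp_neg_tsum_mul_exponential [IsProbabilityMeasure μ] (hm : ∀ i, Measurable (g i))
    (hlaw : ∀ i, HasLaw (g i) (expMeasure 1) μ) (hind : iIndepFun g μ) {s : ℕ → ℝ}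
    (hs0 : ∀ i, 0 ≤ s i) (hs : Summable s) :
    ∫ ω, Real.exp (-∑' i, s i * g i ω) ∂μ = Real.exp (-∑' i, Real.log (1 + s i)) := by
  have hfin : ∀ n : ℕ, ∫ ω, Real.exp (-∑ i ∈ Finset.range n, s i * g i ω) ∂μ =
      Real.exp (-∑ i ∈ Finset.range n, Real.log (1 + s i)) := by
    intro n
    calc ∫ ω, Real.exp (-∑ i ∈ Finset.range n, s i * g i ω) ∂μ
        = ∫ ω, ∏ i : Fin n, Real.exp (-(s i * g i ω)) ∂μ := by
          refine integral_congr_ae (ae_of_all _ fun ω => ?_)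
          simp only
          rw [← Real.exp_sum, Finset.sum_neg_distrib, Fin.sum_univ_eq_sum_range
            (fun i => s i * g i ω)]
      _ = ∏ i : Fin n, ∫ ω, Real.exp (-(s i * g i ω)) ∂μ :=
          iIndepFun.integral_fun_prod_comp (X := fun (i : Fin n) => g i)
            (f := fun (i : Fin n) x => Real.exp (-(s i * x)))
            (hind.precomp Fin.val_injective) (fun i => (hm i).aemeasurable)
            fun i => Measurable.aestronglyMeasurable (by fun_prop)
      _ = ∏ i : Fin n, Real.exp (-Real.log (1 + s i)) := by
          refine Finset.prod_congr rfl fun i _ => ?_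
          rw [← integral_exp_neg_mul_expMeasure (hs0 i)]
          exact (hlaw i).integral_comp (f := fun x => Real.exp (-(s i * x)))
            (Measurable.aestronglyMeasurable (by fun_prop))
      _ = _ := by
          rw [← Real.exp_sum, Finset.sum_neg_distrib, Fin.sum_univ_eq_sum_range
            (fun i => Real.log (1 + s i))]
  have hlog : Summable fun i => Real.log (1 + s i) := by
    refine Summable.of_nonneg_of_le (fun i => Real.log_nonneg (by linarith [hs0 i]))
      (fun i => ?_) hs
    have := Real.log_le_sub_one_of_pos (show 0 < 1 + s i by linarith [hs0 i])
    linarith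
  have hR : Tendsto (fun n => Real.exp (-∑ i ∈ Finset.range n, Real.log (1 + s i))) atTop
      (𝓝 (Real.exp (-∑' i, Real.log (1 + s i)))) :=
    (Real.continuous_exp.tendsto _).comp hlog.hasSum.tendsto_sum_nat.neg
  have hL : Tendsto (fun n => ∫ ω, Real.exp (-∑ i ∈ Finset.range n, s i * g i ω) ∂μ) atTop
      (𝓝 (∫ ω, Real.exp (-∑' i, s i * g i ω) ∂μ)) := by
    -- Weights and gains are nonnegative almost surely, so each exponential is at most `1`.
    refine tendsto_integral_of_dominated_convergence (fun _ => 1)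
      (fun n => Measurable.aestronglyMeasurable (by fun_prop)) (integrable_const _) (fun n => ?_) ?_
    · filter_upwards [ae_all_iff.mpr fun i => ae_nonneg_of_exponential (hlaw i)] with ω hω
      rw [Real.norm_eq_abs, Real.abs_exp, Real.exp_le_one_iff, neg_nonpos]
      exact Finset.sum_nonneg fun i _ => mul_nonneg (hs0 i) (hω i)
    · filter_upwards [ae_summable_mul_exponential hm hlaw hs0 hs] with ω hω
      exact (Real.continuous_exp.tendsto _).comp hω.hasSum.tendsto_sum_nat.neg
  simp_rw [hfin] at hL
  exact tendsto_nhds_unique hL hR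

end Fading

/-! ### Conditioning on an independent variable -/

/-- By independence the conditional distribution of `Y` given `X` is the constant kernel at the law
of `Y`. Conditioning thus freezes `X` and averages over `Y`; below, `Y` is the fading. -/
lemma condExp_comap_eq_integral_of_indepFun {Ω β γ : Type*} [MeasurableSpace Ω]
    [MeasurableSpace β] [MeasurableSpace γ] [StandardBorelSpace γ] [Nonempty γ]
    {μ : Measure Ω} [IsProbabilityMeasure μ] {X : Ω → β} {Y : Ω → γ} (hX : Measurable X)
    (hY : Measurable Y) (hind : IndepFun X Y μ) {f : β × γ → ℝ} (hf : Measurable f)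
    (hint : Integrable (fun ω => f (X ω, Y ω)) μ) :
    μ[fun ω => f (X ω, Y ω) | sigmaOf X] =ᵐ[μ] fun ω => ∫ ω', f (X ω, Y ω') ∂μ := by
  have h1 := condExp_prod_ae_eq_integral_condDistrib hX hY.aemeasurable hf.stronglyMeasurable hint
  have h2 : condDistrib Y X μ =ᵐ[μ.map X] Kernel.const β (μ.map Y) := by
    have : IsProbabilityMeasure (μ.map Y) := Measure.isProbabilityMeasure_map hY.aemeasurable
    refine condDistrib_ae_eq_of_measure_eq_compProd X hY.aemeasurable ?_
    rw [(indepFun_iff_map_prod_eq_prod_map_map hX.aemeasurable hY.aemeasurable).mp hind]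
    exact Measure.compProd_const.symm
  filter_upwards [h1, ae_of_ae_map hX.aemeasurable h2] with ω h3 h4
  rw [h3, h4, Kernel.const_apply, integral_map hY.aemeasurable]
  exact (hf.comp measurable_prodMk_left).aestronglyMeasurable

/-! ### The distance to the nearest point of a Poisson process -/

/-- The infimum is at least `a > 0` exactly when `(-a, a)` contains no point, which has Poisson
probability `exp (-2 lam a)`. Closed half-lines are used so that no attainment of the infimum is
needed. -/
lemma IsPoissonProcess.hasLaw_iInf_abs {Ω : Type*} [MeasurableSpace Ω] {μ : Measure Ω}
    [IsProbabilityMeasure μ] {z : ℕ → Ω → ℝ} {lam : ℝ} (h : IsPoissonProcess μ z lam)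
    (hlam : 0 < lam) : HasLaw (fun ω => ⨅ i, |z i ω|) (expMeasure (2 * lam)) μ := by
  have hm : Measurable fun ω => ⨅ i, |z i ω| := Measurable.iInf fun i => (h.measurable i).abs
  have := isProbabilityMeasure_expMeasure (show 0 < 2 * lam by positivity)
  have : IsProbabilityMeasure (μ.map fun ω => ⨅ i, |z i ω|) :=
    Measure.isProbabilityMeasure_map hm.aemeasurable
  refine ⟨hm.aemeasurable, Measure.ext_of_Ici _ _ fun a => ?_⟩
  rw [Measure.map_apply hm measurableSet_Ici]
  have hiff : ∀ ω, a ≤ ⨅ i, |z i ω| ↔ ∀ i, a ≤ |z i ω| := fun ω =>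
    le_ciInf_iff ⟨0, by rintro _ ⟨i, rfl⟩; exact abs_nonneg _⟩
  rcases le_or_gt a 0 with ha | ha
  · have h1 : (fun ω => ⨅ i, |z i ω|) ⁻¹' Set.Ici a = Set.univ := by
      ext ω
      simpa [hiff] using fun i => ha.trans (abs_nonneg _)
    rw [h1, measure_univ]
    refine le_antisymm ?_ prob_le_one
    calc (1 : ENNReal) = expMeasure (2 * lam) (Set.Ici 0) := by
          rw [expMeasure_Ici (by positivity) le_rfl]
          simp
      _ ≤ _ := measure_mono (Set.Ici_subset_Ici.mpr ha)
  · have h1 : (fun ω => ⨅ i, |z i ω|) ⁻¹' Set.Ici a =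
        {ω | pointCount z ω (Set.Ioo (-a) a) = 0} := by
      ext ω
      simp only [Set.mem_preimage, Set.mem_Ici, hiff, Set.mem_ofPred_eq, pointCount,
        Set.encard_eq_zero, Set.eq_empty_iff_forall_notMem, Set.mem_Ioo, ← abs_lt, not_lt]
    have h2 := (h.hasLaw_count (Set.Ioo (-a) a) measurableSet_Ioo (by simp)).measure_eq
      (p := fun n => n = 0) .of_discrete
    rw [h1, h2, Measure.map_apply .of_discrete .of_discrete]
    have h3 : (fun n : ℕ => (n : ℕ∞)) ⁻¹' {n | n = 0} = {0} := by
      ext n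
      simp
    rw [h3, poissonMeasure_singleton, expMeasure_Ici (by positivity) ha.le,
      Real.volume_real_Ioo_of_le (by linarith), Real.coe_toNNReal _ (by nlinarith)]
    congr 1
    simp
    ring

/-! ### The conditional coverage probability -/

/-- The received power of an interferer at `v`, relative to that of the server at distance `r` and
multiplied by `θ`. -/
def interferenceWeight (α θ r v : ℝ) : ℝ :=
  open Classical in if r < |v| then θ * (r / |v|) ^ α else 0

lemma interferenceWeight_nonneg {α θ r : ℝ} (hθ : 0 ≤ θ) (hr : 0 ≤ r) (v : ℝ) :
    0 ≤ interferenceWeight α θ r v := by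
  unfold interferenceWeight
  split_ifs <;> positivity

/-- For `r < |v|` one has `r / |v| ≤ (1 + r) / (1 + |v|)`. The bound separates `r` from `v`, and its
factor in `v` is integrable when `α > 1`. -/
lemma interferenceWeight_le {α θ r : ℝ} (hα : 0 ≤ α) (hθ : 0 ≤ θ) (hr : 0 ≤ r) (v : ℝ) :
    interferenceWeight α θ r v ≤ θ * (1 + r) ^ α * (1 + |v|) ^ (-α) := by
  unfold interferenceWeight
  split_ifs with h
  · have hv : 0 < |v| := hr.trans_lt h
    rw [Real.rpow_neg (by positivity), mul_assoc, ← div_eq_mul_inv,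
      ← Real.div_rpow (by positivity) (by positivity)]
    gcongr ?_ * ?_
    refine Real.rpow_le_rpow (by positivity) ?_ hα
    rw [div_le_div_iff₀ hv (by positivity)]
    linarith
  · positivity

lemma measurable_interferenceWeight (α θ : ℝ) :
    Measurable fun p : ℝ × ℝ => interferenceWeight α θ p.1 p.2 := by
  unfold interferenceWeight
  refine Measurable.ite (measurableSet_lt (by fun_prop) (by fun_prop)) ?_ measurable_const
  fun_prop

lemma log_one_add_interferenceWeight_nonneg {α θ r : ℝ} (hθ : 0 ≤ θ) (hr : 0 ≤ r) (v : ℝ) :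
    0 ≤ Real.log (1 + interferenceWeight α θ r v) :=
  Real.log_nonneg (by linarith [interferenceWeight_nonneg (α := α) hθ hr v])

lemma log_one_add_interferenceWeight_le {α θ r : ℝ} (hα : 0 ≤ α) (hθ : 0 ≤ θ) (hr : 0 ≤ r)
    (v : ℝ) : Real.log (1 + interferenceWeight α θ r v) ≤
      θ * (1 + r) ^ α * (1 + |v|) ^ (-α) := by
  have h1 := interferenceWeight_nonneg (α := α) hθ hr v
  have h2 := Real.log_le_sub_one_of_pos (show 0 < 1 + interferenceWeight α θ r v by linarith)
  linarith [interferenceWeight_le hα hθ hr v]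

lemma measurable_log_one_add_interferenceWeight (α θ : ℝ) :
    Measurable fun p : ℝ × ℝ => Real.log (1 + interferenceWeight α θ p.1 p.2) :=
  Real.measurable_log.comp ((measurable_interferenceWeight α θ).const_add 1)

lemma integrable_log_one_add_interferenceWeight {α θ r : ℝ} (hα : 1 < α) (hθ : 0 ≤ θ)
    (hr : 0 ≤ r) : Integrable fun v => Real.log (1 + interferenceWeight α θ r v) := by
  have h1 : Integrable fun v : ℝ => (1 + ‖v‖) ^ (-α) := integrable_one_add_norm (by simpa using hα)
  refine (h1.const_mul (θ * (1 + r) ^ α)).mono'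
    ((measurable_log_one_add_interferenceWeight α θ).comp
      measurable_prodMk_left).aestronglyMeasurable (ae_of_all _ fun v => ?_)
  rw [Real.norm_of_nonneg (log_one_add_interferenceWeight_nonneg hθ hr v)]
  exact log_one_add_interferenceWeight_le (zero_le_one.trans hα.le) hθ hr v

lemma summable_interferenceWeight {α θ r : ℝ} (hα : 0 ≤ α) (hθ : 0 ≤ θ) (hr : 0 ≤ r)
    {z : ℕ → ℝ} (hz : Summable fun i => (1 + |z i|) ^ (-α)) :
    Summable fun i => interferenceWeight α θ r (z i) :=
  .of_nonneg_of_le (fun _ => interferenceWeight_nonneg hθ hr _)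
    (fun _ => interferenceWeight_le hα hθ hr _) (hz.mul_left _)

lemma summable_log_one_add_interferenceWeight {α θ r : ℝ} (hα : 0 ≤ α) (hθ : 0 ≤ θ) (hr : 0 ≤ r)
    {z : ℕ → ℝ} (hz : Summable fun i => (1 + |z i|) ^ (-α)) :
    Summable fun i => Real.log (1 + interferenceWeight α θ r (z i)) :=
  .of_nonneg_of_le (fun _ => log_one_add_interferenceWeight_nonneg hθ hr _)
    (fun _ => log_one_add_interferenceWeight_le hα hθ hr _) (hz.mul_left _)

/-- The negative logarithm of the coverage probability, given the serving distance `r` and the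
locations `z` of the active road-side units. -/
def coverageExponent (c : HighwayParams) (θ r : ℝ) (z : ℕ → ℝ) : ℝ :=
  θ * r ^ c.α * c.noise / c.Pt + ∑' i, Real.log (1 + interferenceWeight c.α θ r (z i))

lemma measurable_coverageExponent (c : HighwayParams) (θ : ℝ) :
    Measurable fun p : ℝ × (ℕ → ℝ) => coverageExponent c θ p.1 p.2 := by
  unfold coverageExponent
  refine Measurable.add (by fun_prop) (Measurable.tsum fun i => ?_)
  exact (measurable_log_one_add_interferenceWeight c.α θ).comp
    (measurable_fst.prodMk ((measurable_pi_apply i).comp measurable_snd))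

/-- The signal-to-interference-plus-noise ratio as a function of the locations of the road-side
units, of the active ones, and of the fading gains. -/
def sinrValue (c : HighwayParams) (zr za : ℕ → ℝ) (h : ℝ) (g : ℕ → ℝ) : ℝ :=
  open Classical in
  h * c.Pt * (⨅ i, |zr i|) ^ (-c.α) /
    ((∑' i, if ⨅ i, |zr i| < |za i| then g i * c.Pt * |za i| ^ (-c.α) else 0) + c.noise)

lemma measurable_sinrValue (c : HighwayParams) :
    Measurable fun p : ((ℕ → ℝ) × (ℕ → ℝ)) × (ℝ × (ℕ → ℝ)) =>
      sinrValue c p.1.1 p.1.2 p.2.1 p.2.2 := by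
  unfold sinrValue
  have hr : Measurable fun p : ((ℕ → ℝ) × (ℕ → ℝ)) × (ℝ × (ℕ → ℝ)) => ⨅ i, |p.1.1 i| :=
    Measurable.iInf fun i => by fun_prop
  refine Measurable.div (by fun_prop) (Measurable.add_const (Measurable.tsum fun i => ?_) _)
  exact Measurable.ite (measurableSet_lt hr (by fun_prop)) (by fun_prop) measurable_const

lemma sinrValue_nonneg (c : HighwayParams) (zr za : ℕ → ℝ) {h : ℝ} {g : ℕ → ℝ} (hh : 0 ≤ h)
    (hg : ∀ i, 0 ≤ g i) : 0 ≤ sinrValue c zr za h g := by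
  have := c.Pt_pos
  have := c.noise_pos
  unfold sinrValue
  have h1 : 0 ≤ ⨅ i, |zr i| := Real.iInf_nonneg fun i => abs_nonneg _
  refine div_nonneg (by positivity) (add_nonneg (tsum_nonneg fun i => ?_) c.noise_pos.le)
  have := hg i
  split_ifs <;> positivity

/-- Solving for the serving gain: both sides of `θ (I + σ²) < h Pt r^(-α)` are multiplied by `r^α /
Pt`. -/
lemma lt_sinrValue_iff (c : HighwayParams) {θ : ℝ} (zr za : ℕ → ℝ) {h : ℝ} {g : ℕ → ℝ}
    (hr : 0 < ⨅ i, |zr i|) (hg : ∀ i, 0 ≤ g i) :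
    θ < sinrValue c zr za h g ↔ θ * (⨅ i, |zr i|) ^ c.α * c.noise / c.Pt +
      ∑' i, interferenceWeight c.α θ (⨅ i, |zr i|) (za i) * g i < h := by
  classical
  have hP := c.Pt_pos
  have hn := c.noise_pos
  unfold sinrValue
  set r := ⨅ i, |zr i|
  set I := ∑' i, if r < |za i| then g i * c.Pt * |za i| ^ (-c.α) else 0 with hI
  have hI0 : 0 ≤ I := by
    refine tsum_nonneg fun i => ?_
    have := hg i
    split_ifs <;> positivity
  have hra : 0 < r ^ c.α := Real.rpow_pos_of_pos hr _
  have hsum : ∑' i, interferenceWeight c.α θ r (za i) * g i = θ * r ^ c.α / c.Pt * I := by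
    rw [hI, ← tsum_mul_left]
    refine tsum_congr fun i => ?_
    unfold interferenceWeight
    split_ifs with h
    · have hv : 0 < |za i| := hr.trans h
      rw [Real.div_rpow hr.le hv.le, Real.rpow_neg hv.le]
      field_simp
    · simp
  have hmul : θ * r ^ c.α * c.noise / c.Pt + ∑' i, interferenceWeight c.α θ r (za i) * g i =
      θ * (I + c.noise) * (r ^ c.α / c.Pt) := by
    rw [hsum]
    ring
  have hdiv : h = h * c.Pt * r ^ (-c.α) * (r ^ c.α / c.Pt) := by
    rw [Real.rpow_neg hr.le]
    field_simp
  rw [lt_div_iff₀ (by positivity), hmul]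
  conv_rhs => rw [hdiv]
  rw [mul_lt_mul_iff_left₀ (by positivity)]

lemma sigmaOf_prodMk {Ω β γ : Type*} [MeasurableSpace β] [MeasurableSpace γ] (f : Ω → β)
    (g : Ω → γ) : sigmaOf (fun ω => (f ω, g ω)) = sigmaOf f ⊔ sigmaOf g :=
  MeasurableSpace.comap_prodMk f g

/-! ### Conditional coverage in the link model and the law of total probability -/

namespace Link.IsModel

variable {Ω Ω' : Type*} [MeasurableSpace Ω] [MeasurableSpace Ω'] {μ : Measure Ω}
  {ν : Measure Ω'} {c : HighwayParams} {s : Scenario} {N : Traffic Ω'} {L : Link Ω}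

section Independence

lemma measurable_rsu (hL : L.IsModel μ c N ν s) : Measurable fun ω i => L.rsu i ω :=
  measurable_pi_lambda _ hL.rsu_poisson.measurable

lemma measurable_active (hL : L.IsModel μ c N ν s) : Measurable fun ω i => L.active i ω :=
  measurable_pi_lambda _ hL.active_poisson.measurable

lemma measurable_gains_pi (hL : L.IsModel μ c N ν s) : Measurable fun ω i => L.gains i ω :=
  measurable_pi_lambda _ hL.measurable_gains

lemma sigmaOf_le (hL : L.IsModel μ c N ν s) (j : Fin 5) :
    ![sigmaOf (fun ω i => L.rsu i ω), sigmaOf (fun ω i => L.active i ω),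
      sigmaOf L.gain, sigmaOf (fun ω i => L.gains i ω), sigmaOf L.load] j ≤
      (inferInstance : MeasurableSpace Ω) := by
  fin_cases j
  · exact hL.measurable_rsu.comap_le
  · exact hL.measurable_active.comap_le
  · exact hL.measurable_gain.comap_le
  · exact hL.measurable_gains_pi.comap_le
  · exact hL.measurable_load.comap_le

lemma indepFun_geometry_load_fading (hL : L.IsModel μ c N ν s) :
    IndepFun (fun ω => ((fun i => L.rsu i ω, fun i => L.active i ω), L.load ω))
      (fun ω => (L.gain ω, fun i => L.gains i ω)) μ := by
  have h := indep_iSup_of_disjoint hL.sigmaOf_le hL.indep (S := {0, 1, 4}) (T := {2, 3})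
    (by simp)
  rw [IndepFun_iff_Indep]
  change Indep (sigmaOf _) (sigmaOf _) μ
  rw [sigmaOf_prodMk, sigmaOf_prodMk, sigmaOf_prodMk]
  simp only [iSup_insert, iSup_singleton, ← sup_assoc] at h
  exact h

lemma indepFun_gains_gain (hL : L.IsModel μ c N ν s) :
    IndepFun (fun ω i => L.gains i ω) L.gain μ := by
  rw [IndepFun_iff_Indep]
  exact hL.indep.indep (i := 3) (j := 2) (by decide)

lemma indepFun_rsu_active (hL : L.IsModel μ c N ν s) :
    IndepFun (fun ω i => L.rsu i ω) (fun ω i => L.active i ω) μ := by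
  rw [IndepFun_iff_Indep]
  exact hL.indep.indep (i := 0) (j := 1) (by decide)

lemma indepFun_load_geometry (hL : L.IsModel μ c N ν s) :
    IndepFun L.load (fun ω => (fun i => L.rsu i ω, fun i => L.active i ω)) μ := by
  have h := indep_iSup_of_disjoint hL.sigmaOf_le hL.indep (S := {4}) (T := {0, 1})
    (by simp)
  rw [IndepFun_iff_Indep]
  change Indep (sigmaOf _) (sigmaOf _) μ
  rw [sigmaOf_prodMk]
  simp only [iSup_insert, iSup_singleton] at h
  exact h

end Independence

lemma activeDensity_nonneg : 0 ≤ N.activeProb ν s * c.lamR :=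
  mul_nonneg measureReal_nonneg c.lamR_pos.le

lemma measurable_servingDist (hL : L.IsModel μ c N ν s) : Measurable L.servingDist :=
  Measurable.iInf fun i => (hL.rsu_poisson.measurable i).abs

lemma hasLaw_servingDist [IsProbabilityMeasure μ] (hL : L.IsModel μ c N ν s) :
    HasLaw L.servingDist (expMeasure (2 * c.lamR)) μ :=
  hL.rsu_poisson.hasLaw_iInf_abs c.lamR_pos

lemma ae_servingDist_pos [IsProbabilityMeasure μ] (hL : L.IsModel μ c N ν s) :
    ∀ᵐ ω ∂μ, 0 < L.servingDist ω := by
  have h := ae_pos_expMeasure (2 * c.lamR)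
  rw [← hL.hasLaw_servingDist.map_eq] at h
  exact ae_of_ae_map hL.hasLaw_servingDist.aemeasurable h

lemma ae_summable_active (hL : L.IsModel μ c N ν s) :
    ∀ᵐ ω ∂μ, Summable fun i => (1 + |L.active i ω|) ^ (-c.α) := by
  have h1 : Integrable fun v : ℝ => (1 + ‖v‖) ^ (-c.α) :=
    integrable_one_add_norm (by simpa using c.one_lt_α)
  have h2 := hL.active_poisson.ae_summable_norm activeDensity_nonneg (f := fun v : ℝ =>
    (1 + ‖v‖) ^ (-c.α)) (by fun_prop) h1
  filter_upwards [h2] with ω hω using hω.of_norm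

/-- The probability of coverage for fixed locations of the road-side units. -/
lemma measureReal_lt_sinrValue [IsProbabilityMeasure μ] (hL : L.IsModel μ c N ν s) {θ : ℝ}
    (hθ : 0 ≤ θ) {zr za : ℕ → ℝ} (hr : 0 < ⨅ i, |zr i|)
    (hz : Summable fun i => (1 + |za i|) ^ (-c.α)) :
    μ.real {ω | θ < sinrValue c zr za (L.gain ω) (fun i => L.gains i ω)} =
      Real.exp (-coverageExponent c θ (⨅ i, |zr i|) za) := by
  set r := ⨅ i, |zr i|
  have hP := c.Pt_pos
  have hn := c.noise_pos
  have hα : 0 ≤ c.α := zero_le_one.trans c.one_lt_α.le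
  let V : (ℕ → ℝ) → ℝ := fun g => θ * r ^ c.α * c.noise / c.Pt +
    ∑' i, interferenceWeight c.α θ r (za i) * g i
  have hVm : Measurable V := Measurable.const_add (Measurable.tsum fun i => by fun_prop) _
  have hgains : ∀ᵐ ω ∂μ, ∀ i, 0 ≤ L.gains i ω :=
    ae_all_iff.mpr fun i => ae_nonneg_of_exponential (hL.gains_law i)
  have h1 : μ.real {ω | θ < sinrValue c zr za (L.gain ω) (fun i => L.gains i ω)} =
      μ.real {ω | V (fun i => L.gains i ω) < L.gain ω} := by
    refine measureReal_congr ?_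
    filter_upwards [hgains] with ω hω
    exact propext (lt_sinrValue_iff c zr za hr hω)
  -- The serving gain is averaged out first, leaving `exp (-V)`; the interfering gains inside `V`
  -- are then averaged by their Laplace transform.
  rw [h1, measureReal_lt_exponential (V := fun ω => V fun i => L.gains i ω)
    (hVm.comp hL.measurable_gains_pi) hL.measurable_gain
    hL.gain_law (hL.indepFun_gains_gain.comp hVm measurable_id)]
  · simp only [V, neg_add, Real.exp_add, coverageExponent]
    rw [integral_const_mul, integral_exp_neg_tsum_mul_exponential hL.measurable_gains hL.gains_law
      hL.gains_indep (fun i => interferenceWeight_nonneg hθ hr.le _)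
      (summable_interferenceWeight hα hθ hr.le hz)]
  · filter_upwards [hgains] with ω hω
    have := Real.rpow_nonneg hr.le c.α
    exact add_nonneg (by positivity) (tsum_nonneg fun i =>
      mul_nonneg (interferenceWeight_nonneg hθ hr.le _) (hω i))

lemma condCoverage_ae_eq [IsProbabilityMeasure μ] (hL : L.IsModel μ c N ν s) {θ : ℝ}
    (hθ : 0 ≤ θ) :
    L.condCoverage μ c θ =ᵐ[μ]
      fun ω => Real.exp (-coverageExponent c θ (L.servingDist ω) fun i => L.active i ω) := by
  let S : Set (((ℕ → ℝ) × (ℕ → ℝ)) × (ℝ × (ℕ → ℝ))) :=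
    {p | θ < sinrValue c p.1.1 p.1.2 p.2.1 p.2.2}
  have hS : MeasurableSet S := measurableSet_lt measurable_const (measurable_sinrValue c)
  have hX := hL.measurable_rsu.prodMk hL.measurable_active
  have hY := hL.measurable_gain.prodMk hL.measurable_gains_pi
  have hind := hL.indepFun_geometry_load_fading.comp measurable_fst measurable_id
  have h := condExp_comap_eq_integral_of_indepFun hX hY hind
    (f := S.indicator fun _ => 1) (measurable_const.indicator hS)
    ((integrable_const (1 : ℝ)).indicator ((hX.prodMk hY) hS))
  have hgeo : L.geometry = sigmaOf fun ω => (fun i => L.rsu i ω, fun i => L.active i ω) :=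
    (sigmaOf_prodMk _ _).symm
  rw [Link.condCoverage, hgeo]
  refine EventuallyEq.trans h ?_
  filter_upwards [hL.ae_servingDist_pos, hL.ae_summable_active] with ω hr hz
  refine Eq.trans ?_ (hL.measureReal_lt_sinrValue hθ hr hz)
  exact integral_indicator_one ((measurable_prodMk_left.comp hY) hS)

/-- Locations and load are frozen together. The rate condition is then a SINR condition whose
threshold depends on the frozen load. -/
lemma condRateCoverage_ae_eq [IsProbabilityMeasure μ] (hL : L.IsModel μ c N ν s) {τ : ℝ}
    (hτ : 0 < τ) :
    L.condRateCoverage μ c τ =ᵐ[μ]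
      fun ω => Real.exp (-coverageExponent c (sinrThreshold (τ * (L.load ω + 1) / c.B))
        (L.servingDist ω) fun i => L.active i ω) := by
  have hB := c.B_pos
  let S : Set ((((ℕ → ℝ) × (ℕ → ℝ)) × ℕ) × (ℝ × (ℕ → ℝ))) :=
    {p | τ < c.B / (p.1.2 + 1) *
      Real.logb 2 (1 + sinrValue c p.1.1.1 p.1.1.2 p.2.1 p.2.2)}
  have hS : MeasurableSet S := by
    refine measurableSet_lt measurable_const (Measurable.mul ?_ ?_)
    · exact measurable_const.div
        (((measurable_from_top (f := fun n : ℕ => (n : ℝ))).comp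
          (measurable_snd.comp measurable_fst)).add_const 1)
    · refine (Real.measurable_log.comp (Measurable.const_add ?_ 1)).div_const _
      exact (measurable_sinrValue c).comp
        ((measurable_fst.comp measurable_fst).prodMk measurable_snd)
  have hX := (hL.measurable_rsu.prodMk hL.measurable_active).prodMk hL.measurable_load
  have hY := hL.measurable_gain.prodMk hL.measurable_gains_pi
  have h := condExp_comap_eq_integral_of_indepFun hX hY hL.indepFun_geometry_load_fading
    (f := S.indicator fun _ => 1) (measurable_const.indicator hS)
    ((integrable_const (1 : ℝ)).indicator ((hX.prodMk hY) hS))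
  have hgeo : L.geometry ⊔ sigmaOf L.load =
      sigmaOf fun ω => ((fun i => L.rsu i ω, fun i => L.active i ω), L.load ω) := by
    rw [sigmaOf_prodMk, sigmaOf_prodMk]
  rw [Link.condRateCoverage, hgeo]
  refine EventuallyEq.trans h ?_
  filter_upwards [hL.ae_servingDist_pos, hL.ae_summable_active] with ω hr hz
  have hθ : 0 ≤ sinrThreshold (τ * (L.load ω + 1) / c.B) :=
    sub_nonneg.mpr (Real.one_le_rpow one_le_two (by positivity))
  refine Eq.trans ?_ (hL.measureReal_lt_sinrValue hθ hr hz)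
  refine (integral_indicator_one ((measurable_prodMk_left.comp hY) hS)).trans ?_
  refine measureReal_congr ?_
  filter_upwards [ae_all_iff.mpr fun i => ae_nonneg_of_exponential (hL.gains_law i),
    ae_nonneg_of_exponential hL.gain_law] with ω' hg hh
  refine propext ?_
  have hs := sinrValue_nonneg c (fun i => L.rsu i ω) (fun i => L.active i ω) hh hg
  change τ < c.B / (L.load ω + 1) * Real.logb 2 (1 + sinrValue c (fun i => L.rsu i ω)
    (fun i => L.active i ω) (L.gain ω') fun i => L.gains i ω') ↔ _ < _
  rw [sinrThreshold, sub_lt_iff_lt_add', ← Real.lt_logb_iff_rpow_lt one_lt_two (by linarith),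
    div_lt_iff₀ hB, div_mul_eq_mul_div, lt_div_iff₀ (by positivity), mul_comm c.B]

/-- The law of total probability for the meta distribution of the rate coverage. -/
theorem hasSum_rateMeta [IsProbabilityMeasure μ] (hL : L.IsModel μ c N ν s) {τ : ℝ}
    (hτ : 0 < τ) (x : ℝ) :
    HasSum (fun k : ℕ => ν.real {ω | N.taggedLoad s ω = k} *
      L.coverageMeta μ c (sinrThreshold (τ * (k + 1) / c.B)) x) (L.rateMeta μ c τ x) := by
  have hB := c.B_pos
  let G : ℕ → Ω → ℝ := fun k ω => Real.exp (-coverageExponent c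
    (sinrThreshold (τ * (k + 1) / c.B)) (L.servingDist ω) fun i => L.active i ω)
  let K : ℕ → Set ((ℕ → ℝ) × (ℕ → ℝ)) := fun k => {p | x < Real.exp (-coverageExponent c
    (sinrThreshold (τ * (k + 1) / c.B)) (⨅ i, |p.1 i|) p.2)}
  have hK : ∀ k, MeasurableSet (K k) := by
    intro k
    refine measurableSet_lt measurable_const (Real.measurable_exp.comp (Measurable.neg ?_))
    exact (measurable_coverageExponent c _).comp
      ((Measurable.iInf fun i => by fun_prop).prodMk measurable_snd)
  have hload : ∀ k : ℕ, ν.real {ω | N.taggedLoad s ω = k} = μ.real (L.load ⁻¹' {k}) := by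
    intro k
    have h := hL.load_law.measure_mem_eq (s := {(k : ℕ∞)}) .of_discrete
    rw [measureReal_def, measureReal_def]
    refine congrArg ENNReal.toReal (h.symm.trans (congrArg μ ?_))
    ext ω
    simp
  have hgeo := hL.measurable_rsu.prodMk hL.measurable_active
  have hterm : ∀ k : ℕ, ν.real {ω | N.taggedLoad s ω = k} *
      L.coverageMeta μ c (sinrThreshold (τ * (k + 1) / c.B)) x =
      μ.real (L.load ⁻¹' {k} ∩ {ω | x < G k ω}) := by
    intro k
    have hθ : 0 ≤ sinrThreshold (τ * (k + 1) / c.B) :=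
      sub_nonneg.mpr (Real.one_le_rpow one_le_two (by positivity))
    have h1 : L.coverageMeta μ c (sinrThreshold (τ * (k + 1) / c.B)) x =
        μ.real {ω | x < G k ω} := by
      refine measureReal_congr ?_
      filter_upwards [hL.condCoverage_ae_eq hθ] with ω hω
      exact propext (by change x < _ ↔ x < _; rw [hω])
    rw [hload, h1, measureReal_def, measureReal_def, measureReal_def, ← ENNReal.toReal_mul]
    congr 1
    exact (hL.indepFun_load_geometry.measure_inter_preimage_eq_mul {k} (K k) .of_discrete
      (hK k)).symm
  have hrate : L.rateMeta μ c τ x = μ.real (⋃ k : ℕ, L.load ⁻¹' {k} ∩ {ω | x < G k ω}) := by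
    refine measureReal_congr ?_
    filter_upwards [hL.condRateCoverage_ae_eq hτ] with ω hω
    refine propext ?_
    change x < _ ↔ ω ∈ ⋃ k : ℕ, L.load ⁻¹' {k} ∩ {ω | x < G k ω}
    rw [hω]
    simp [G]
  simp_rw [hterm]
  rw [hrate]
  -- The finite values of the load partition the event, and independence of load and locations has
  -- already factored each piece.
  have hdisj : Pairwise (Function.onFun Disjoint
      fun k : ℕ => L.load ⁻¹' {k} ∩ {ω | x < G k ω}) := by
    intro i j hij
    refine Disjoint.mono Set.inter_subset_left Set.inter_subset_left (Disjoint.preimage _ ?_)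
    simpa using hij
  have hmeas : ∀ k : ℕ, MeasurableSet (L.load ⁻¹' {k} ∩ {ω | x < G k ω}) := fun k =>
    (hL.measurable_load .of_discrete).inter (hgeo (hK k))
  have h2 := measure_iUnion (μ := μ) hdisj hmeas
  rw [measureReal_def, h2]
  rw [ENNReal.tsum_toReal_eq fun k => measure_ne_top _ _]
  exact ENNReal.hasSum_toReal (by rw [← h2]; exact measure_ne_top _ _)

end Link.IsModel

/-! ### The characteristic function of the coverage exponent -/

/-- Change of variables for functions of the interference weight. -/
lemma integral_comp_interferenceWeight {α θ r : ℝ} (hα : 0 < α) (hr : 0 < r) {φ : ℝ → ℝ}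
    (hφ : φ 0 = 0) :
    ∫ v, φ (interferenceWeight α θ r v) =
      2 * r / α * ∫ y in (0 : ℝ)..1, φ (θ * y) * y ^ (-(1 + 1 / α)) := by
  classical
  let f : ℝ → ℝ := fun u => if r < u then φ (θ * (r / u) ^ α) else 0
  have h1 : ∀ v, φ (interferenceWeight α θ r v) = f |v| := by
    intro v
    simp only [interferenceWeight, f]
    split_ifs
    · rfl
    · exact hφ
  simp_rw [h1]
  rw [integral_comp_abs]
  -- The substitution is `u = r x^(-1/α)`, done as a scaling followed by a power. It turns `(r /
  -- u)^α` into `x` and `r < u` into `x < 1`.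
  have h2 : ∫ u in Set.Ioi (0 : ℝ), f u = r * ∫ w in Set.Ioi (0 : ℝ), f (r * w) := by
    have h := integral_comp_mul_left_Ioi f 0 hr
    rw [mul_zero, smul_eq_mul] at h
    rw [h]
    field_simp
  have hp : -(1 / α) ≠ 0 := neg_ne_zero.mpr (by positivity)
  have h3 := integral_comp_rpow_Ioi (fun w => f (r * w)) hp
  have h4 : ∫ x in Set.Ioi (0 : ℝ), (|(-(1 / α))| * x ^ (-(1 / α) - 1)) • f (r * x ^ (-(1 / α))) =
      1 / α * ∫ y in (0 : ℝ)..1, φ (θ * y) * y ^ (-(1 + 1 / α)) := by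
    rw [intervalIntegral.integral_of_le zero_le_one, integral_Ioc_eq_integral_Ioo,
      ← integral_const_mul, ← Set.Ioi_inter_Iio,
      ← setIntegral_indicator measurableSet_Iio]
    refine setIntegral_congr_fun measurableSet_Ioi fun x hx => ?_
    have hx : 0 < x := hx
    have hxp : 0 < x ^ (-(1 / α)) := Real.rpow_pos_of_pos hx _
    have hiff : r < r * x ^ (-(1 / α)) ↔ x ∈ Set.Iio 1 := by
      rw [lt_mul_iff_one_lt_right hr, Set.mem_Iio]
      exact Real.one_lt_rpow_iff_of_pos hx |>.trans
        ⟨fun h => h.resolve_left (fun h' => by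
          have : 0 < 1 / α := by positivity
          linarith [h'.2]) |>.1, fun h => Or.inr ⟨h, by
          have : 0 < 1 / α := by positivity
          linarith⟩⟩
    have hval : (r / (r * x ^ (-(1 / α)))) ^ α = x := by
      rw [div_mul_cancel_left₀ hr.ne', ← Real.rpow_neg hx.le, neg_neg, ← Real.rpow_mul hx.le,
        one_div_mul_cancel hα.ne', Real.rpow_one]
    have hexp : -(1 / α) - 1 = -(1 + 1 / α) := by ring
    simp only [f, smul_eq_mul]
    rw [hval, hexp, abs_neg, abs_of_pos (by positivity : 0 < 1 / α)]
    by_cases h : x ∈ Set.Iio 1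
    · rw [if_pos (hiff.mpr h), Set.indicator_of_mem h]
      ring
    · rw [if_neg (fun h' => h (hiff.mp h')), Set.indicator_of_notMem h, mul_zero]
  rw [h2, ← h3, h4]
  ring

lemma integral_one_sub_cexp_log_interferenceWeight {α θ r : ℝ} (hα : 1 < α) (hθ : 0 ≤ θ)
    (hr : 0 < r) (t : ℝ) :
    ∫ v, (1 - Complex.exp (Complex.I *
        (t * Real.log (1 + interferenceWeight α θ r v) : ℝ))) =
      (2 * r / α * ∫ y in (0 : ℝ)..1,
          (1 - Real.cos (t * Real.log (1 + θ * y))) * y ^ (-(1 + 1 / α)) : ℝ) -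
        Complex.I * (2 * r / α * ∫ y in (0 : ℝ)..1,
          Real.sin (t * Real.log (1 + θ * y)) * y ^ (-(1 + 1 / α)) : ℝ) := by
  have hα0 : 0 < α := zero_lt_one.trans hα
  set u : ℝ → ℝ := fun v => t * Real.log (1 + interferenceWeight α θ r v) with hu
  have hum : Measurable u := ((measurable_log_one_add_interferenceWeight α θ).comp
    measurable_prodMk_left).const_mul t
  have hui : Integrable u := (integrable_log_one_add_interferenceWeight hα hθ hr.le).const_mul t
  have hI := integrable_one_sub_cexp_I hum hui
  have hre : ∀ v, (1 - Complex.exp (Complex.I * u v)).re = 1 - Real.cos (u v) := by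
    intro v
    rw [mul_comm, Complex.sub_re, Complex.exp_ofReal_mul_I_re, Complex.one_re]
  have him : ∀ v, (1 - Complex.exp (Complex.I * u v)).im = -Real.sin (u v) := by
    intro v
    rw [mul_comm, Complex.sub_im, Complex.exp_ofReal_mul_I_im, Complex.one_im, zero_sub]
  have h1 := integral_comp_interferenceWeight (θ := θ) hα0 hr
    (φ := fun x => 1 - Real.cos (t * Real.log (1 + x))) (by simp)
  have h2 := integral_comp_interferenceWeight (θ := θ) hα0 hr
    (φ := fun x => Real.sin (t * Real.log (1 + x))) (by simp)
  have h3 := integral_re_add_im hI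
  simp only [RCLike.re_to_complex, RCLike.im_to_complex, hre, him] at h3
  rw [← h3, ← h1, ← h2, integral_neg]
  simp [hu]
  ring

lemma measurable_sin_coverageExponent (c : HighwayParams) (θ b t : ℝ) :
    Measurable fun p : ℝ × (ℕ → ℝ) => Real.sin (t * (coverageExponent c θ p.1 p.2 + b)) :=
  Real.measurable_sin.comp (((measurable_coverageExponent c θ).add_const b).const_mul t)

/-! ### Absence of atoms -/

lemma finite_setOf_abs_le_of_summable {α : ℝ} (hα : 0 < α) {z : ℕ → ℝ}
    (hz : Summable fun i => (1 + |z i|) ^ (-α)) {r : ℝ} (hr : 0 < r) :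
    {i | |z i| ≤ r}.Finite := by
  have h1 := hz.tendsto_cofinite_zero.eventually_lt_const
    (show 0 < (1 + r) ^ (-α) by positivity)
  refine Set.Finite.subset (eventually_cofinite.mp h1) fun i hi => ?_
  have hi : |z i| ≤ r := hi
  exact not_lt.mpr (Real.rpow_le_rpow_of_nonpos (by positivity) (by linarith) (by linarith))

/-- With the same interferers present, every weight grows with `r`, while the noise term grows
strictly. -/
lemma coverageExponent_lt (c : HighwayParams) {θ : ℝ} (hθ : 0 < θ) {z : ℕ → ℝ}
    (hz : Summable fun i => (1 + |z i|) ^ (-c.α)) {r r' : ℝ} (hr : 0 < r) (hrr : r < r')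
    (hset : {i | |z i| ≤ r} = {i | |z i| ≤ r'}) :
    coverageExponent c θ r z < coverageExponent c θ r' z := by
  have hα : 0 < c.α := zero_lt_one.trans c.one_lt_α
  have hP := c.Pt_pos
  have hn := c.noise_pos
  have hr' := hr.trans hrr
  refine add_lt_add_of_lt_of_le ?_ ?_
  · have := Real.rpow_lt_rpow hr.le hrr hα
    gcongr
  · refine Summable.tsum_le_tsum (fun i => ?_)
      (summable_log_one_add_interferenceWeight hα.le hθ.le hr.le hz)
      (summable_log_one_add_interferenceWeight hα.le hθ.le hr'.le hz)
    have h0 := interferenceWeight_nonneg (α := c.α) hθ.le hr.le (z i)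
    refine Real.log_le_log (by linarith) (add_le_add_right ?_ 1)
    have hiff : r < |z i| ↔ r' < |z i| := by
      have := Set.ext_iff.mp hset i
      simp only [Set.mem_ofPred_eq] at this
      rw [← not_le, ← not_le, this]
    unfold interferenceWeight
    by_cases h : r < |z i|
    · rw [if_pos h, if_pos (hiff.mp h)]
      have hv : 0 < |z i| := hr.trans h
      gcongr
    · rw [if_neg h, if_neg (fun h' => h (hiff.mpr h'))]

/-- On a level set, `r` is determined by the indices of the points within distance `r`. These form a
finite subset of `ℕ`, and there are countably many such subsets. -/
lemma countable_setOf_coverageExponent_eq (c : HighwayParams) {θ : ℝ} (hθ : 0 < θ) {z : ℕ → ℝ}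
    (hz : Summable fun i => (1 + |z i|) ^ (-c.α)) (y : ℝ) :
    {r | 0 < r ∧ coverageExponent c θ r z = y}.Countable := by
  have hα : 0 < c.α := zero_lt_one.trans c.one_lt_α
  refine Set.MapsTo.countable_of_injOn (f := fun r => {i | |z i| ≤ r})
    (t := {s : Set ℕ | s.Finite}) (fun r hr => finite_setOf_abs_le_of_summable hα hz hr.1) ?_
    Set.Countable.ofPred_finite
  intro r hr r' hr' hset
  have heq : coverageExponent c θ r z = coverageExponent c θ r' z := hr.2.trans hr'.2.symm
  rcases lt_trichotomy r r' with h | h | h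
  · exact absurd heq (coverageExponent_lt c hθ hz hr.1 h hset).ne
  · exact h
  · exact absurd heq (coverageExponent_lt c hθ hz hr'.1 h hset.symm).ne'

/-! ### Integrability, null level sets and the inversion formula in the link model -/

namespace Link.IsModel

variable {Ω Ω' : Type*} [MeasurableSpace Ω] [MeasurableSpace Ω'] {μ : Measure Ω}
  {ν : Measure Ω'} {c : HighwayParams} {s : Scenario} {N : Traffic Ω'} {L : Link Ω}

lemma measurable_coverageExponent (hL : L.IsModel μ c N ν s) (θ : ℝ) :
    Measurable fun ω => coverageExponent c θ (L.servingDist ω) fun i => L.active i ω :=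
  (_root_.measurable_coverageExponent c θ).comp
    (hL.measurable_servingDist.prodMk hL.measurable_active)

lemma indepFun_servingDist_active (hL : L.IsModel μ c N ν s) :
    IndepFun L.servingDist (fun ω i => L.active i ω) μ :=
  hL.indepFun_rsu_active.comp (φ := fun z : ℕ → ℝ => ⨅ i, |z i|)
    (Measurable.iInf fun i => by fun_prop) measurable_id

variable [IsProbabilityMeasure μ]

lemma map_servingDist_active (hL : L.IsModel μ c N ν s) :
    μ.map (fun ω => (L.servingDist ω, fun i => L.active i ω)) =
      (expMeasure (2 * c.lamR)).prod (μ.map fun ω i => L.active i ω) := by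
  rw [← hL.hasLaw_servingDist.map_eq]
  exact (indepFun_iff_map_prod_eq_prod_map_map hL.measurable_servingDist.aemeasurable
    hL.measurable_active.aemeasurable).mp hL.indepFun_servingDist_active

/-- The separated bound on the weights dominates the interference part by a function of the serving
distance times a function of the active units. Both factors are integrable and they are independent,
so their product is integrable. -/
lemma integrable_coverageExponent (hL : L.IsModel μ c N ν s) {θ : ℝ} (hθ : 0 ≤ θ) :
    Integrable (fun ω => coverageExponent c θ (L.servingDist ω) fun i => L.active i ω) μ := by
  have hα : 0 ≤ c.α := zero_le_one.trans c.one_lt_α.le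
  have hP := c.Pt_pos
  have hn := c.noise_pos
  have hR : Integrable (fun ω => (1 + |L.servingDist ω|) ^ c.α) μ := by
    have h := integrable_one_add_rpow_expMeasure (show 0 < 2 * c.lamR by linarith [c.lamR_pos]) c.α
    rw [← hL.hasLaw_servingDist.map_eq] at h
    exact h.comp_measurable hL.measurable_servingDist
  have hκ : Integrable fun v : ℝ => (1 + |v|) ^ (-c.α) :=
    integrable_one_add_norm (by simpa using c.one_lt_α)
  have hκm : Measurable fun v : ℝ => (1 + |v|) ^ (-c.α) := by fun_prop
  have hZ : Integrable (fun ω => ∑' i, (1 + |L.active i ω|) ^ (-c.α)) μ := by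
    refine ⟨(hL.active_poisson.measurable_tsum_comp hκm).aestronglyMeasurable, ?_⟩
    exact (hL.active_poisson.lintegral_enorm_tsum_le activeDensity_nonneg hκm).trans_lt
      (ENNReal.mul_lt_top ENNReal.ofReal_lt_top hκ.2)
  have hind : IndepFun (fun ω => (1 + |L.servingDist ω|) ^ c.α)
      (fun ω => ∑' i, (1 + |L.active i ω|) ^ (-c.α)) μ :=
    hL.indepFun_servingDist_active.comp (φ := fun r : ℝ => (1 + |r|) ^ c.α)
      (ψ := fun z : ℕ → ℝ => ∑' i, (1 + |z i|) ^ (-c.α)) (by fun_prop)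
      (Measurable.tsum fun i => by fun_prop)
  have hRZ := hind.integrable_mul hR hZ
  refine ((hR.const_mul (θ * c.noise / c.Pt)).add (hRZ.const_mul θ)).mono'
    (hL.measurable_coverageExponent θ).aestronglyMeasurable ?_
  filter_upwards [hL.ae_servingDist_pos, hL.ae_summable_active] with ω hr hz
  have h1 : 0 ≤ ∑' i, Real.log (1 + interferenceWeight c.α θ (L.servingDist ω) (L.active i ω)) :=
    tsum_nonneg fun i => log_one_add_interferenceWeight_nonneg hθ hr.le _
  have h2 : ∑' i, Real.log (1 + interferenceWeight c.α θ (L.servingDist ω) (L.active i ω)) ≤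
      θ * (1 + L.servingDist ω) ^ c.α * ∑' i, (1 + |L.active i ω|) ^ (-c.α) := by
    rw [← tsum_mul_left]
    exact Summable.tsum_le_tsum (fun i => log_one_add_interferenceWeight_le hα hθ hr.le _)
      (summable_log_one_add_interferenceWeight hα hθ hr.le hz) (hz.mul_left _)
  have h3 : L.servingDist ω ^ c.α ≤ (1 + L.servingDist ω) ^ c.α :=
    Real.rpow_le_rpow hr.le (by linarith) hα
  rw [Real.norm_of_nonneg (by unfold coverageExponent; positivity)]
  simp only [Pi.add_apply, Pi.mul_apply, abs_of_pos hr]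
  unfold coverageExponent
  refine add_le_add ?_ (by rw [← mul_assoc]; exact h2)
  calc θ * L.servingDist ω ^ c.α * c.noise / c.Pt
      = θ * c.noise / c.Pt * L.servingDist ω ^ c.α := by ring
    _ ≤ _ := by gcongr

lemma measure_coverageExponent_eq (hL : L.IsModel μ c N ν s) {θ : ℝ} (hθ : 0 < θ) (y : ℝ) :
    μ {ω | coverageExponent c θ (L.servingDist ω) (fun i => L.active i ω) = y} = 0 := by
  have hpos : 0 < 2 * c.lamR := by linarith [c.lamR_pos]
  have := isProbabilityMeasure_expMeasure hpos
  have : IsProbabilityMeasure (μ.map fun ω i => L.active i ω) :=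
    Measure.isProbabilityMeasure_map hL.measurable_active.aemeasurable
  let S : Set (ℝ × (ℕ → ℝ)) := {p | coverageExponent c θ p.1 p.2 = y}
  have hS : MeasurableSet S :=
    measurableSet_eq_fun (_root_.measurable_coverageExponent c θ) measurable_const
  have h1 : μ {ω | coverageExponent c θ (L.servingDist ω) (fun i => L.active i ω) = y} =
      μ.map (fun ω => (L.servingDist ω, fun i => L.active i ω)) S := by
    rw [Measure.map_apply (hL.measurable_servingDist.prodMk hL.measurable_active) hS]
    rfl
  rw [h1, hL.map_servingDist_active, Measure.prod_apply_symm hS,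
    lintegral_eq_zero_iff (measurable_measure_prodMk_right hS)]
  have hz : ∀ᵐ z ∂(μ.map fun ω i => L.active i ω), Summable fun i => (1 + |z i|) ^ (-c.α) := by
    refine (ae_map_iff hL.measurable_active.aemeasurable ?_).mpr hL.ae_summable_active
    -- Summability is recast as finiteness of an extended sum, which makes the set visibly
    -- measurable.
    have heq : {z : ℕ → ℝ | Summable fun i => (1 + |z i|) ^ (-c.α)} =
        {z | ∑' i, ENNReal.ofReal ((1 + |z i|) ^ (-c.α)) ≠ ⊤} := by
      ext z
      refine ⟨fun h => h.tsum_ofReal_ne_top, fun h => ?_⟩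
      have h' := ENNReal.summable_toReal h
      have h0 : ∀ i, (ENNReal.ofReal ((1 + |z i|) ^ (-c.α))).toReal = (1 + |z i|) ^ (-c.α) :=
        fun i => ENNReal.toReal_ofReal (by positivity)
      simp only [h0] at h'
      exact h'
    rw [heq]
    exact (measurableSet_eq_fun (Measurable.tsum fun i => by fun_prop) measurable_const).compl
  -- By Fubini it suffices to fix the active units: the level set in the serving distance is then
  -- countable, hence null.
  filter_upwards [hz] with z hz
  have hc := countable_setOf_coverageExponent_eq c hθ hz y
  have h2 := expMeasure_absolutelyContinuous (2 * c.lamR) (hc.measure_zero volume)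
  refine measure_mono_null_ae ?_ h2
  filter_upwards [ae_pos_expMeasure (2 * c.lamR)] with r hr h
  exact ⟨hr, h⟩

/-- The sine is the imaginary part of `exp (i (shift + Σ h))`. The shift is deterministic for fixed
`r`, and the rest is the characteristic functional at `h`, whose exponent splits into modulus and
phase. -/
lemma integral_sin_fixed_distance (hL : L.IsModel μ c N ν s) {θ : ℝ} (hθ : 0 ≤ θ) {r : ℝ}
    (hr : 0 < r) (x t : ℝ) :
    ∫ ω, Real.sin (t * (coverageExponent c θ r (fun i => L.active i ω) + Real.log x)) ∂μ =
      metaModulus c (N.activeProb ν s) θ t r *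
        Real.sin (metaPhase c (N.activeProb ν s) θ t r + metaShift c θ x t r) := by
  set p := N.activeProb ν s
  set h : ℝ → ℝ := fun v => t * Real.log (1 + interferenceWeight c.α θ r v) with hh
  have hm : Measurable h := ((measurable_log_one_add_interferenceWeight c.α θ).comp
    measurable_prodMk_left).const_mul t
  have hi : Integrable h :=
    (integrable_log_one_add_interferenceWeight c.one_lt_α hθ hr.le).const_mul t
  have hphase : ∀ ω, t * (coverageExponent c θ r (fun i => L.active i ω) + Real.log x) =
      metaShift c θ x t r + ∑' i, h (L.active i ω) := by
    intro ω
    have := c.Pt_pos.ne'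
    have := c.noise_pos.ne'
    simp only [hh, coverageExponent, metaShift, tsum_mul_left]
    field_simp
    ring
  have hmeas := hL.active_poisson.measurable_tsum_comp hm
  have hcint : Integrable (fun ω => Complex.exp (Complex.I *
      (metaShift c θ x t r + ∑' i, h (L.active i ω) : ℝ))) μ := by
    refine (integrable_const (1 : ℝ)).mono' (Measurable.aestronglyMeasurable (by fun_prop))
      (ae_of_all _ fun ω => ?_)
    rw [Complex.norm_exp_I_mul_ofReal]
  calc ∫ ω, Real.sin (t * (coverageExponent c θ r (fun i => L.active i ω) + Real.log x)) ∂μ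
      = ∫ ω, (Complex.exp (Complex.I *
          (metaShift c θ x t r + ∑' i, h (L.active i ω) : ℝ))).im ∂μ := by
        refine integral_congr_ae (ae_of_all _ fun ω => ?_)
        simp only
        rw [hphase, mul_comm Complex.I, Complex.exp_ofReal_mul_I_im]
    _ = (∫ ω, Complex.exp (Complex.I *
          (metaShift c θ x t r + ∑' i, h (L.active i ω) : ℝ)) ∂μ).im :=
        integral_im hcint
    _ = (Complex.exp (Complex.I * metaShift c θ x t r) *
          ∫ ω, Complex.exp (Complex.I * (∑' i, h (L.active i ω) : ℝ)) ∂μ).im := by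
        rw [← integral_const_mul]
        congr 2
        ext ω
        rw [← Complex.exp_add]
        push_cast
        ring_nf
    _ = (Complex.exp ((-(2 * p * c.lamR * r / c.α) *
            ∫ y in (0 : ℝ)..1, (1 - Real.cos (t * Real.log (1 + θ * y))) *
              y ^ (-(1 + 1 / c.α)) : ℝ) +
          (metaPhase c p θ t r + metaShift c θ x t r : ℝ) * Complex.I)).im := by
        rw [hL.active_poisson.integral_cexp_tsum activeDensity_nonneg hm hi,
          integral_one_sub_cexp_log_interferenceWeight c.one_lt_α hθ hr t, ← Complex.exp_add]
        congr 2
        simp only [metaPhase]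
        push_cast
        ring
    _ = _ := by
        rw [Complex.exp_add, ← Complex.ofReal_exp, Complex.im_ofReal_mul,
          Complex.exp_ofReal_mul_I_im]
        rfl

lemma integral_sin_coverageExponent (hL : L.IsModel μ c N ν s) {θ : ℝ} (hθ : 0 ≤ θ) (x t : ℝ) :
    ∫ ω, Real.sin (t * (coverageExponent c θ (L.servingDist ω) (fun i => L.active i ω) +
        Real.log x)) ∂μ =
      ∫ r in Set.Ioi (0 : ℝ), metaModulus c (N.activeProb ν s) θ t r *
        Real.sin (metaPhase c (N.activeProb ν s) θ t r + metaShift c θ x t r) *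
          (2 * c.lamR * Real.exp (-2 * c.lamR * r)) := by
  have hpos : 0 < 2 * c.lamR := by linarith [c.lamR_pos]
  have := isProbabilityMeasure_expMeasure hpos
  have : IsProbabilityMeasure (μ.map fun ω i => L.active i ω) :=
    Measure.isProbabilityMeasure_map hL.measurable_active.aemeasurable
  have hsm := measurable_sin_coverageExponent c θ (Real.log x) t
  have h1 : ∫ ω, Real.sin (t * (coverageExponent c θ (L.servingDist ω) (fun i => L.active i ω) +
      Real.log x)) ∂μ = ∫ p, Real.sin (t * (coverageExponent c θ p.1 p.2 + Real.log x))
        ∂(μ.map fun ω => (L.servingDist ω, fun i => L.active i ω)) :=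
    (integral_map (hL.measurable_servingDist.prodMk hL.measurable_active).aemeasurable
      hsm.aestronglyMeasurable).symm
  have hint : Integrable (fun p : ℝ × (ℕ → ℝ) =>
      Real.sin (t * (coverageExponent c θ p.1 p.2 + Real.log x)))
      ((expMeasure (2 * c.lamR)).prod (μ.map fun ω i => L.active i ω)) :=
    (integrable_const (1 : ℝ)).mono' hsm.aestronglyMeasurable
      (ae_of_all _ fun p => Real.abs_sin_le_one _)
  rw [h1, hL.map_servingDist_active, integral_prod _ hint, integral_expMeasure hpos]
  refine setIntegral_congr_fun measurableSet_Ioi fun r hr => ?_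
  simp only
  rw [integral_map (f := fun z => Real.sin (t * (coverageExponent c θ r z + Real.log x)))
    hL.measurable_active.aemeasurable (hsm.comp measurable_prodMk_left).aestronglyMeasurable,
    hL.integral_sin_fixed_distance hθ hr x t]
  simp [neg_mul]

/-- The inversion formula for the meta distribution of the coverage probability. -/
theorem tendsto_coverageMetaTrunc (hL : L.IsModel μ c N ν s) {θ : ℝ} (hθ : 0 < θ) {x : ℝ}
    (hx : 0 < x) :
    Tendsto (coverageMetaTrunc c (N.activeProb ν s) θ x) atTop (𝓝 (L.coverageMeta μ c θ x)) := by
  let Y : Ω → ℝ := fun ω =>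
    coverageExponent c θ (L.servingDist ω) (fun i => L.active i ω) + Real.log x
  have hmeta : L.coverageMeta μ c θ x = μ.real {ω | Y ω < 0} := by
    refine measureReal_congr ?_
    filter_upwards [hL.condCoverage_ae_eq hθ.le] with ω hω
    refine propext ?_
    change x < _ ↔ _ + _ < _
    rw [hω, ← Real.log_lt_iff_lt_exp hx]
    constructor <;> intro h <;> linarith
  have h := tendsto_gilPelaez (μ := μ) (Y := Y)
    ((hL.measurable_coverageExponent θ).add_const _)
    ((hL.integrable_coverageExponent hθ.le).add (integrable_const _)) (by
      have h0 := hL.measure_coverageExponent_eq hθ (-Real.log x)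
      simpa only [Y, add_eq_zero_iff_eq_neg] using h0)
  rw [hmeta]
  refine h.congr fun T => ?_
  simp only [coverageMetaTrunc, Y, hL.integral_sin_coverageExponent hθ.le]

end Link.IsModel

end

theorem theorem12 {Ω Ω' : Type*} [MeasurableSpace Ω] [MeasurableSpace Ω']
    (μ : Measure Ω) [IsProbabilityMeasure μ] (ν : Measure Ω') [IsProbabilityMeasure ν]
    (c : HighwayParams) (s : Scenario) (N : Traffic Ω') (hN : N.IsModel ν c)
    (L : Link Ω) (hL : L.IsModel μ c N ν s) (τ : ℝ) (hτ : 0 < τ) :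
    (∀ x : ℝ, HasSum
      (fun k : ℕ => ν.real {ω | N.taggedLoad s ω = k} *
        L.coverageMeta μ c (sinrThreshold (τ * (k + 1) / c.B)) x)
      (L.rateMeta μ c τ x)) ∧
    ∀ (k : ℕ) (x : ℝ), 0 < x →
      Tendsto (coverageMetaTrunc c (N.activeProb ν s) (sinrThreshold (τ * (k + 1) / c.B)) x)
        atTop (𝓝 (L.coverageMeta μ c (sinrThreshold (τ * (k + 1) / c.B)) x)) := by
  refine ⟨hL.hasSum_rateMeta hτ, fun k x hx => hL.tendsto_coverageMetaTrunc ?_ hx⟩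
  have hB := c.B_pos
  -- The threshold must be strictly positive: at `θ = 0` the exponent vanishes identically and the
  -- absence of atoms fails.
  exact sub_pos.mpr (Real.one_lt_rpow one_lt_two (by positivity))
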